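/- Let $\mathcal A$ be a unital $C^\ast$-algebra and let $\mathcal A_{\mathbb Z}=\mathcal A^{\otimes\mathbb Z}$ be the completion, in the maximal $C^\ast$-norm (the only $C^\ast$-norm when $\mathcal A$ is nuclear), of the $\ast$-algebra spanned by the monomials $\bigotimes_{n\in\mathbb Z}a_n$ with $a_n\in\mathcal A$ and $a_n=1$ for all but finitely many $n$. For $a\in\mathcal A$ let $\alpha_j^{-1}(a)\in\mathcal A_{\mathbb Z}$ be the monomial with $a$ at the site $j$ and $1$ elsewhere. Let $\mathcal A_L$ and $\mathcal A_R$ be the $C^\ast$-subalgebras generated by the sites $n\le 0$ and $n\ge 1$, let $S(\bigotimes a_n)=\bigotimes a_{n-1}$ be the shift automorphism of $\mathcal A_{\mathbb Z}$, and set $$\xi_R(a\otimes a_R)=S\big(\alpha_0^{-1}(a)\,a_R\big)\in\mathcal A_R ,\qquad a\in\mathcal A,\ a_R\in\mathcal A_R .$$ Let $\omega$ be a state on $\mathcal A_{\mathbb Z}$ with $\omega\circ S=\omega$. Put $$\mathcal K_\omega=\{a_R\in\mathcal A_R:\ \omega(x\,a_R)=0\ \text{ for all } x\in\mathcal A_L\},\qquad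 \mathcal B_\omega=\mathcal A_R/\mathcal K_\omega ,$$ write $\lfloor a_R\rfloor$ for the class of $a_R$, $\lfloor a_R\rfloor^\ast=\lfloor a_R^\ast\rfloor$, and $e=\lfloor 1\rfloor$. Equip $\mathcal B_\omega$ with its operator system structure: a matrix $[\lfloor a_{ij}\rfloor]\in M_n(\mathcal B_\omega)$ is positive if for every $\epsilon>0$ there are $k_{ij}\in\mathcal K_\omega$ such that $\epsilon 1+[a_{ij}+k_{ij}]$ is a positive element of $M_n(\mathcal A_R)$; the matrix norms are $$\|x\|^{\rm osy}=\inf\Big\{r\ge 0:\ \begin{pmatrix} r\,e & x\\ x^\ast & r\,e\end{pmatrix}\ \text{is positive}\Big\},\qquad x\in M_{m,n}(\mathcal B_\omega)$$ (with $re$ standing for $r$ times the diagonal matrix with all diagonal entries $e$). The Haagerup matrix norms on the algebraic tensor product $\mathcal A\otimes\mathcal B_\omega$ are $$\|x\|_{\rm h}=\inf\big\{\|u\|\,\|v\|^{\rm osy}:\ p\ge 0,\ u\in M_{m,p}(\mathcal A),\ v\in M_{p,n}(\mathcal B_\omega),\ x=u\odot v\big\},\qquad (u\odot v)_{ij}=\sum_{k}u_{ik}\otimes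 v_{kj},$$ and $\mathcal A\otimes_{\rm h}\mathcal B_\omega$ is the completion of $\mathcal A\otimes\mathcal B_\omega$ in $\|\cdot\|_{\rm h}$, with the extended matrix norms. Let $\overline{\mathcal B}_\omega$ be the completion of $\mathcal B_\omega$ in $\|\cdot\|^{\rm osy}$, with the extended matrix norms. Then: 1. $\mathbb E(a,\lfloor a_R\rfloor)=\lfloor\xi_R(a\otimes a_R)\rfloor$ (formally $\lfloor a\otimes a_R\rfloor$) is a well-defined bilinear map $\mathbb E:\mathcal A\times\mathcal B_\omega\to\mathcal B_\omega$. 2. $\mathbb E$ is completely contractive: for all $n$, $x\in M_n(\mathcal A)$ and $y\in M_n(\mathcal B_\omega)$, $$\Big\|\Big[\sum_k\mathbb E(x_{ik},y_{kj})\Big]_{ij}\Big\|^{\rm osy}\le\|x\|\,\|y\|^{\rm osy}.$$ 3. Consequently the linear map $\mathcal A\otimes\mathcal B_\omega\to\mathcal B_\omega$, $a\otimes b\mapsto\mathbb E(a,b)$, is completely contractive for the norms $\|\cdot\|_{\rm h}$ and $\|\cdot\|^{\rm osy}$, and $\mathbb E$ extends to a completely contractive linear map $\Phi:\mathcal A\otimes_{\rm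 h}\mathcal B_\omega\to\overline{\mathcal B}_\omega$ with $\Phi(a\otimes b)=\mathbb E(a,b)$ for all $a\in\mathcal A$, $b\in\mathcal B_\omega$; it is unital: $\Phi(1\otimes e)=e$. -/

import Mathlib

open scoped TensorProduct ComplexOrder
universe u

namespace OPS

section AlgebraicTensorPower

variable (A : Type u) [CStarAlgebra A]

/-- The full algebraic tensor product of copies of `A` indexed by `ℤ`. -/
abbrev BigTensor : Type u := ⨂[ℂ] _ : ℤ, A

/-- The additive map `⊗ aₙ ↦ ⊗ aₙ⋆` (conjugate linear). -/
noncomputable def starHom : BigTensor A →+ BigTensor A :=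
  PiTensorProduct.liftAddHom
    (fun p => PiTensorProduct.tprodCoeff ℂ (star p.1) (fun n => star (p.2 n)))
    (fun r f i h => PiTensorProduct.zero_tprodCoeff' _ _ i (by simp [h]))
    (fun f => by simp)
    (fun r f i m₁ m₂ => by
      have key : ∀ m : A, (fun n => star (Function.update f i m n))
          = Function.update (fun n => star (f n)) i (star m) := fun m => by
        funext n
        by_cases h : n = i
        · subst h; simp
        · simp [h]
      simp only [key, star_add]
      exact PiTensorProduct.add_tprodCoeff _ _ _ _ _)
    (fun r r' f => by
      simp only [star_add]
      exact PiTensorProduct.add_tprodCoeff' _ _ _)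
    (fun r f i r' => by
      have key : ∀ m : A, (fun n => star (Function.update f i m n))
          = Function.update (fun n => star (f n)) i (star m) := fun m => by
        funext n
        by_cases h : n = i
        · subst h; simp
        · simp [h]
      simp only [key, star_smul, star_mul']
      have := PiTensorProduct.smul_tprodCoeff (R := ℂ) (star r) (fun n => star (f n)) i (star r')
      simpa [smul_eq_mul] using this)

lemma starHom_tprodCoeff (r : ℂ) (f : ℤ → A) :
    starHom A (PiTensorProduct.tprodCoeff ℂ r f)
      = PiTensorProduct.tprodCoeff ℂ (star r) (fun n => star (f n)) := by
  rfl

lemma starHom_smul_tprod (r : ℂ) (f : ℤ → A) :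
    starHom A (r • PiTensorProduct.tprod ℂ f)
      = star r • PiTensorProduct.tprod ℂ (fun n => star (f n)) := by
  rw [← PiTensorProduct.tprodCoeff_eq_smul_tprod, starHom_tprodCoeff,
    PiTensorProduct.tprodCoeff_eq_smul_tprod]

noncomputable instance : StarRing (BigTensor A) where
  star := starHom A
  star_involutive x := by
    induction x using PiTensorProduct.induction_on with
    | smul_tprod r f => simp [starHom_smul_tprod]
    | add x y hx hy => simp only [map_add, hx, hy]
  star_mul x y := by
    change starHom A (x * y) = starHom A y * starHom A x
    induction x using PiTensorProduct.induction_on with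
    | add x y hx hy => rw [add_mul, map_add, hx, hy, map_add, mul_add]
    | smul_tprod r f =>
      induction y using PiTensorProduct.induction_on with
      | add x y hx hy => rw [mul_add, map_add, hx, hy, map_add, add_mul]
      | smul_tprod s g =>
        rw [PiTensorProduct.smul_tprod_mul_smul_tprod, starHom_smul_tprod, starHom_smul_tprod,
          starHom_smul_tprod, PiTensorProduct.smul_tprod_mul_smul_tprod, star_mul]
        congr 2
        funext n
        simp
  star_add x y := map_add _ x y

lemma star_smul_tprod (r : ℂ) (f : ℤ → A) :
    star (r • PiTensorProduct.tprod ℂ f : BigTensor A)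
      = star r • PiTensorProduct.tprod ℂ (fun n => star (f n)) :=
  starHom_smul_tprod A r f

lemma star_tprod (f : ℤ → A) :
    star (PiTensorProduct.tprod ℂ f : BigTensor A)
      = PiTensorProduct.tprod ℂ (fun n => star (f n)) := by
  simpa using star_smul_tprod A 1 f

instance : StarModule ℂ (BigTensor A) where
  star_smul r x := by
    induction x using PiTensorProduct.induction_on with
    | add x y hx hy => rw [smul_add, star_add, hx, hy, star_add, smul_add]
    | smul_tprod s f => rw [smul_smul, star_smul_tprod, star_smul_tprod, smul_smul, star_mul']

/-- `a ↦ ⋯ ⊗ 1 ⊗ a ⊗ 1 ⊗ ⋯`, with `a` at the site `j`. -/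
noncomputable def bigSite (j : ℤ) : A →⋆ₐ[ℂ] BigTensor A :=
  { PiTensorProduct.singleAlgHom (R := ℂ) (A := fun _ : ℤ => A) j with
    map_star' := fun a => by
      change PiTensorProduct.tprod ℂ (Pi.mulSingle (M := fun _ : ℤ => A) j (star a))
        = star (PiTensorProduct.tprod ℂ (Pi.mulSingle (M := fun _ : ℤ => A) j a))
      rw [star_tprod]
      congr 1
      funext n
      by_cases h : n = j
      · subst h; simp
      · simp [h] }

/-- The algebraic tensor power of `A` over `ℤ`: the `⋆`-algebra of finite linear combinations of
monomials `⊗ aₙ` with all but finitely many `aₙ` equal to `1`. -/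
noncomputable def algPow : StarSubalgebra ℂ (BigTensor A) :=
  StarAlgebra.adjoin ℂ (⋃ j : ℤ, Set.range (bigSite A j))

/-- `algPow A` as a type. -/
def AlgPow : Type u := algPow A

noncomputable instance : Ring (AlgPow A) := inferInstanceAs (Ring (algPow A))
noncomputable instance : StarRing (AlgPow A) := inferInstanceAs (StarRing (algPow A))
noncomputable instance : Algebra ℂ (AlgPow A) := inferInstanceAs (Algebra ℂ (algPow A))
instance : StarModule ℂ (AlgPow A) := inferInstanceAs (StarModule ℂ (algPow A))

/-- The embedding of `A` at the site `j`. -/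
noncomputable def algSite (j : ℤ) : A →⋆ₐ[ℂ] AlgPow A :=
  (bigSite A j).codRestrict (algPow A) (fun a =>
    StarAlgebra.subset_adjoin ℂ _ (Set.mem_iUnion.2 ⟨j, a, rfl⟩))

/-- An induction principle for the algebraic tensor power. -/
lemma algPow_induction {P : AlgPow A → Prop} (site : ∀ j a, P (algSite A j a))
    (scalar : ∀ r : ℂ, P (algebraMap ℂ (AlgPow A) r))
    (add : ∀ x y, P x → P y → P (x + y)) (mul : ∀ x y, P x → P y → P (x * y))
    (hstar : ∀ x, P x → P (star x)) (x : AlgPow A) : P x := by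
  obtain ⟨x, hx⟩ := x
  induction hx using StarAlgebra.adjoin_induction with
  | mem x hx =>
    obtain ⟨j, a, rfl⟩ := Set.mem_iUnion.1 hx
    exact site j a
  | algebraMap r => exact scalar r
  | add x y hx hy h1 h2 => exact add _ _ h1 h2
  | mul x y hx hy h1 h2 => exact mul _ _ h1 h2
  | star x hx h => exact hstar _ h

lemma algSite_commute {i j : ℤ} (h : i ≠ j) (a b : A) :
    Commute (algSite A i a) (algSite A j b) := by
  apply Subtype.ext
  change PiTensorProduct.tprod ℂ (Pi.mulSingle (M := fun _ : ℤ => A) i a)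
      * PiTensorProduct.tprod ℂ (Pi.mulSingle (M := fun _ : ℤ => A) j b)
    = PiTensorProduct.tprod ℂ (Pi.mulSingle (M := fun _ : ℤ => A) j b)
      * PiTensorProduct.tprod ℂ (Pi.mulSingle (M := fun _ : ℤ => A) i a)
  rw [PiTensorProduct.tprod_mul_tprod, PiTensorProduct.tprod_mul_tprod]
  congr 1
  exact Pi.mulSingle_commute (f := fun _ : ℤ => A) h a b

end AlgebraicTensorPower


section MaximalNorm

variable (A : Type u) [CStarAlgebra A]

/-- The norms of the images of `x` under the unital `⋆`-homomorphisms into `C⋆`-algebras. -/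
def repNorms (x : AlgPow A) : Set ℝ :=
  {r | ∃ (D : Type u) (_ : CStarAlgebra D) (π : AlgPow A →⋆ₐ[ℂ] D), r = ‖π x‖}

/-- The maximal `C⋆`-norm on the algebraic tensor power. -/
noncomputable def maxNorm (x : AlgPow A) : ℝ := sSup (repNorms A x)

variable {A}

lemma rep_site_le {D : Type u} [CStarAlgebra D] (π : AlgPow A →⋆ₐ[ℂ] D) (j : ℤ) (a : A) :
    ‖π (algSite A j a)‖ ≤ ‖a‖ :=
  NonUnitalStarAlgHom.norm_apply_le (π.comp (algSite A j)) a

lemma repNorms_bddAbove (x : AlgPow A) : BddAbove (repNorms A x) := by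
  induction x using algPow_induction with
  | site j a =>
    refine ⟨‖a‖, ?_⟩
    rintro _ ⟨D, _, π, rfl⟩
    exact rep_site_le π j a
  | scalar r =>
    refine ⟨‖r‖, ?_⟩
    rintro _ ⟨D, _, π, rfl⟩
    rw [AlgHomClass.commutes, Algebra.algebraMap_eq_smul_one]
    refine (norm_smul_le _ _).trans ?_
    exact mul_le_of_le_one_right (norm_nonneg _) (by
      rcases subsingleton_or_nontrivial D with h | h
      · rw [Subsingleton.elim (1 : D) 0]; simp
      · simp)
  | add x y hx hy =>
    obtain ⟨C, hC⟩ := hx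
    obtain ⟨C', hC'⟩ := hy
    refine ⟨C + C', ?_⟩
    rintro _ ⟨D, _, π, rfl⟩
    rw [map_add]
    exact (norm_add_le _ _).trans (add_le_add (hC ⟨D, _, π, rfl⟩) (hC' ⟨D, _, π, rfl⟩))
  | mul x y hx hy =>
    obtain ⟨C, hC⟩ := hx
    obtain ⟨C', hC'⟩ := hy
    refine ⟨C * C', ?_⟩
    rintro _ ⟨D, _, π, rfl⟩
    rw [map_mul]
    have h1 : ‖π x‖ ≤ C := hC ⟨D, _, π, rfl⟩
    have h2 : ‖π y‖ ≤ C' := hC' ⟨D, _, π, rfl⟩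
    exact (norm_mul_le _ _).trans
      (mul_le_mul h1 h2 (norm_nonneg _) ((norm_nonneg _).trans h1))
  | hstar x hx =>
    obtain ⟨C, hC⟩ := hx
    refine ⟨C, ?_⟩
    rintro _ ⟨D, _, π, rfl⟩
    rw [map_star, norm_star]
    exact hC ⟨D, _, π, rfl⟩

lemma rep_le_maxNorm {D : Type u} [CStarAlgebra D] (π : AlgPow A →⋆ₐ[ℂ] D) (x : AlgPow A) :
    ‖π x‖ ≤ maxNorm A x :=
  le_csSup (repNorms_bddAbove x) ⟨D, _, π, rfl⟩

lemma maxNorm_nonneg (x : AlgPow A) : 0 ≤ maxNorm A x := by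
  refine Real.sSup_nonneg ?_
  rintro _ ⟨D, _, π, rfl⟩
  exact norm_nonneg _

lemma maxNorm_le {x : AlgPow A} {C : ℝ} (hC : 0 ≤ C)
    (h : ∀ (D : Type u) [CStarAlgebra D] (π : AlgPow A →⋆ₐ[ℂ] D), ‖π x‖ ≤ C) :
    maxNorm A x ≤ C := by
  refine Real.sSup_le ?_ hC
  rintro _ ⟨D, _, π, rfl⟩
  exact h D π

noncomputable instance : SeminormedRing (AlgPow A) :=
  RingSeminorm.toSeminormedRing
    { toFun := maxNorm A
      map_zero' := le_antisymm (maxNorm_le le_rfl fun D _ π => by simp) (maxNorm_nonneg _)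
      add_le' := fun x y => maxNorm_le (add_nonneg (maxNorm_nonneg _) (maxNorm_nonneg _)) fun D _ π => by
        rw [map_add]
        exact (norm_add_le _ _).trans (add_le_add (rep_le_maxNorm π x) (rep_le_maxNorm π y))
      neg' := fun x => by
        refine le_antisymm (maxNorm_le (maxNorm_nonneg _) fun D _ π => ?_) (maxNorm_le (maxNorm_nonneg _) fun D _ π => ?_)
        · rw [map_neg, norm_neg]; exact rep_le_maxNorm π x
        · have := rep_le_maxNorm π (-x)
          rwa [map_neg, norm_neg] at this
      mul_le' := fun x y => maxNorm_le (mul_nonneg (maxNorm_nonneg _) (maxNorm_nonneg _)) fun D _ π => by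
        rw [map_mul]
        exact (norm_mul_le _ _).trans
          (mul_le_mul (rep_le_maxNorm π x) (rep_le_maxNorm π y) (norm_nonneg _)
            (maxNorm_nonneg _)) }

lemma norm_algPow (x : AlgPow A) : ‖x‖ = maxNorm A x := rfl

noncomputable instance : NormedAlgebra ℂ (AlgPow A) where
  norm_smul_le r x := maxNorm_le (mul_nonneg (norm_nonneg _) (maxNorm_nonneg _)) fun D _ π => by
    rw [map_smul]
    exact (norm_smul_le _ _).trans
      (mul_le_mul_of_nonneg_left (rep_le_maxNorm π x) (norm_nonneg _))

lemma norm_star_algPow (x : AlgPow A) : ‖star x‖ = ‖x‖ := by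
  refine le_antisymm (maxNorm_le (maxNorm_nonneg _) fun D _ π => ?_) (maxNorm_le (maxNorm_nonneg _) fun D _ π => ?_)
  · rw [map_star, norm_star]; exact rep_le_maxNorm π x
  · have := rep_le_maxNorm π (star x)
    rwa [map_star, norm_star] at this

lemma norm_mul_self_le_algPow (x : AlgPow A) : ‖x‖ * ‖x‖ ≤ ‖star x * x‖ := by
  have h : ‖x‖ ≤ Real.sqrt ‖star x * x‖ := maxNorm_le (Real.sqrt_nonneg _) fun D _ π => by
    refine Real.le_sqrt_of_sq_le ?_
    rw [sq, ← CStarRing.norm_star_mul_self, ← map_star, ← map_mul]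
    exact rep_le_maxNorm π _
  calc ‖x‖ * ‖x‖ ≤ Real.sqrt ‖star x * x‖ * Real.sqrt ‖star x * x‖ :=
        mul_self_le_mul_self (norm_nonneg _) h
    _ = ‖star x * x‖ := Real.mul_self_sqrt (norm_nonneg _)

/-- A `⋆`-endomorphism of the algebraic tensor power is contractive. -/
lemma norm_endo_le (φ : AlgPow A →⋆ₐ[ℂ] AlgPow A) (x : AlgPow A) : ‖φ x‖ ≤ ‖x‖ :=
  maxNorm_le (maxNorm_nonneg _) fun _ _ π => rep_le_maxNorm (π.comp φ) x

end MaximalNorm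

section TensorPower

open UniformSpace

variable (A : Type u) [CStarAlgebra A]

/-- The `C⋆`-algebra `A^{⊗ℤ}` of physical observables: the completion of the algebraic tensor power
in its maximal `C⋆`-norm. -/
def AZ : Type u := Completion (AlgPow A)

noncomputable instance : NormedRing (AZ A) := inferInstanceAs (NormedRing (Completion (AlgPow A)))
instance : CompleteSpace (AZ A) := inferInstanceAs (CompleteSpace (Completion (AlgPow A)))
noncomputable instance : NormedAlgebra ℂ (AZ A) where
  toAlgebra := inferInstanceAs (Algebra ℂ (Completion (AlgPow A)))
  norm_smul_le := norm_smul_le (α := ℂ) (β := Completion (AlgPow A))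

/-- The canonical map from the algebraic tensor power. -/
noncomputable def toAZ (x : AlgPow A) : AZ A := ((x : Completion (AlgPow A)) : AZ A)

variable {A}

lemma norm_toAZ (x : AlgPow A) : ‖toAZ A x‖ = ‖x‖ := Completion.norm_coe x
lemma toAZ_add (x y : AlgPow A) : toAZ A (x + y) = toAZ A x + toAZ A y := Completion.coe_add x y
lemma toAZ_mul (x y : AlgPow A) : toAZ A (x * y) = toAZ A x * toAZ A y := Completion.coe_mul x y
lemma toAZ_one : toAZ A 1 = 1 := Completion.coe_one _
lemma toAZ_smul (r : ℂ) (x : AlgPow A) : toAZ A (r • x) = r • toAZ A x := Completion.coe_smul r x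
lemma continuous_toAZ : Continuous (toAZ A) := Completion.continuous_coe _
lemma denseRange_toAZ : DenseRange (toAZ A) := Completion.denseRange_coe

lemma uniformContinuous_star_algPow : UniformContinuous (star : AlgPow A → AlgPow A) := by
  refine LipschitzWith.uniformContinuous (K := 1) (LipschitzWith.of_dist_le_mul fun x y => ?_)
  rw [dist_eq_norm, dist_eq_norm, ← star_sub, norm_star_algPow]
  simp

noncomputable instance : Star (AZ A) := ⟨Completion.map star⟩

lemma star_toAZ (x : AlgPow A) : star (toAZ A x) = toAZ A (star x) :=
  Completion.map_coe uniformContinuous_star_algPow x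

lemma continuous_star_AZ : Continuous (star : AZ A → AZ A) := Completion.continuous_map

noncomputable instance : StarRing (AZ A) where
  star_involutive x := by
    refine denseRange_toAZ.induction_on (p := fun x : AZ A => star (star x) = x) x
      (isClosed_eq (continuous_star_AZ.comp continuous_star_AZ) continuous_id) fun y => ?_
    rw [star_toAZ, star_toAZ, star_star]
  star_mul x y := by
    refine denseRange_toAZ.induction_on₂ (p := fun x y : AZ A => star (x * y) = star y * star x)
      (isClosed_eq (continuous_star_AZ.comp continuous_mul)
        ((continuous_star_AZ.comp continuous_snd).mul (continuous_star_AZ.comp continuous_fst)))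
      (fun x y => ?_) x y
    rw [← toAZ_mul, star_toAZ, star_mul, toAZ_mul, star_toAZ, star_toAZ]
  star_add x y := by
    refine denseRange_toAZ.induction_on₂ (p := fun x y : AZ A => star (x + y) = star x + star y)
      (isClosed_eq (continuous_star_AZ.comp continuous_add)
        ((continuous_star_AZ.comp continuous_fst).add (continuous_star_AZ.comp continuous_snd)))
      (fun x y => ?_) x y
    rw [← toAZ_add, star_toAZ, star_add, toAZ_add, star_toAZ, star_toAZ]

noncomputable instance : CStarAlgebra (AZ A) where
  norm_mul_self_le x := by
    refine denseRange_toAZ.induction_on (p := fun x : AZ A => ‖x‖ * ‖x‖ ≤ ‖star x * x‖) x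
      (isClosed_le (continuous_norm.mul continuous_norm)
        (continuous_norm.comp (continuous_star_AZ.mul continuous_id))) fun y => ?_
    rw [star_toAZ, ← toAZ_mul, norm_toAZ, norm_toAZ]
    exact norm_mul_self_le_algPow y
  star_smul r x := by
    refine denseRange_toAZ.induction_on (p := fun x : AZ A => star (r • x) = star r • star x) x
      (isClosed_eq (continuous_star_AZ.comp (continuous_const_smul r))
        ((continuous_const_smul (star r)).comp continuous_star_AZ)) fun y => ?_
    rw [← toAZ_smul, star_toAZ, star_smul, toAZ_smul, star_toAZ]

variable (A)

/-- The canonical map from the algebraic tensor power, as a `⋆`-homomorphism. -/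
noncomputable def toAZHom : AlgPow A →⋆ₐ[ℂ] AZ A where
  toFun := toAZ A
  map_one' := toAZ_one
  map_mul' := toAZ_mul
  map_zero' := Completion.coe_zero
  map_add' := toAZ_add
  commutes' r := by
    rw [Algebra.algebraMap_eq_smul_one, toAZ_smul, toAZ_one, Algebra.algebraMap_eq_smul_one]
  map_star' x := (star_toAZ x).symm

/-- `α_j⁻¹`: the embedding of the local algebra `A` at the site `j`. -/
noncomputable def site (j : ℤ) : A →⋆ₐ[ℂ] AZ A := (toAZHom A).comp (algSite A j)

end TensorPower

section Shift

open UniformSpace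

variable (A : Type u) [CStarAlgebra A]

/-- The shift `⊗ aₙ ↦ ⊗ aₙ₋ₖ` on the full algebraic tensor product. -/
noncomputable def bigShift (k : ℤ) : BigTensor A →⋆ₐ[ℂ] BigTensor A :=
  { AlgHom.ofLinearMap
      (PiTensorProduct.reindex ℂ (fun _ : ℤ => A) (Equiv.addRight k)).toLinearMap
      (by
        change PiTensorProduct.reindex ℂ (fun _ : ℤ => A) (Equiv.addRight k)
          (PiTensorProduct.tprod ℂ 1) = PiTensorProduct.tprod ℂ 1
        rw [PiTensorProduct.reindex_tprod]
        rfl)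
      (fun x y => by
        change PiTensorProduct.reindex ℂ (fun _ : ℤ => A) (Equiv.addRight k) (x * y)
          = PiTensorProduct.reindex ℂ (fun _ : ℤ => A) (Equiv.addRight k) x
            * PiTensorProduct.reindex ℂ (fun _ : ℤ => A) (Equiv.addRight k) y
        induction x using PiTensorProduct.induction_on with
        | add x y hx hy => rw [add_mul, map_add, hx, hy, map_add, add_mul]
        | smul_tprod r f =>
          induction y using PiTensorProduct.induction_on with
          | add x y hx hy => rw [mul_add, map_add, hx, hy, map_add, mul_add]
          | smul_tprod s g =>
            rw [PiTensorProduct.smul_tprod_mul_smul_tprod, map_smul, map_smul, map_smul,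
              PiTensorProduct.reindex_tprod, PiTensorProduct.reindex_tprod,
              PiTensorProduct.reindex_tprod]
            erw [PiTensorProduct.smul_tprod_mul_smul_tprod]
            rfl) with
    map_star' := fun x => by
      change PiTensorProduct.reindex ℂ (fun _ : ℤ => A) (Equiv.addRight k) (star x)
        = star (PiTensorProduct.reindex ℂ (fun _ : ℤ => A) (Equiv.addRight k) x : BigTensor A)
      induction x using PiTensorProduct.induction_on with
      | add x y hx hy => rw [star_add, map_add, hx, hy, map_add, star_add]
      | smul_tprod r f =>
        rw [star_smul_tprod, map_smul, map_smul, PiTensorProduct.reindex_tprod,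
          PiTensorProduct.reindex_tprod]
        exact (star_smul_tprod A r _).symm }

lemma bigShift_tprod (k : ℤ) (f : ℤ → A) :
    bigShift A k (PiTensorProduct.tprod ℂ f) = PiTensorProduct.tprod ℂ (fun n => f (n - k)) := by
  change PiTensorProduct.reindex ℂ (fun _ : ℤ => A) (Equiv.addRight k)
    (PiTensorProduct.tprod ℂ f) = _
  rw [PiTensorProduct.reindex_tprod]
  rfl

lemma bigShift_bigSite (k j : ℤ) (a : A) :
    bigShift A k (bigSite A j a) = bigSite A (j + k) a := by
  change bigShift A k (PiTensorProduct.tprod ℂ (Pi.mulSingle (M := fun _ : ℤ => A) j a))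
    = PiTensorProduct.tprod ℂ (Pi.mulSingle (M := fun _ : ℤ => A) (j + k) a)
  rw [bigShift_tprod]
  congr 1
  funext n
  by_cases h : n = j + k
  · subst h; simp
  · have : n - k ≠ j := fun h' => h (by omega)
    simp [h, this]

lemma bigShift_mem (k : ℤ) {x : BigTensor A} (hx : x ∈ algPow A) :
    bigShift A k x ∈ algPow A := by
  have : algPow A ≤ (algPow A).comap (bigShift A k) := by
    refine StarAlgebra.adjoin_le ?_
    rintro _ ⟨_, ⟨j, rfl⟩, a, rfl⟩
    change bigShift A k (bigSite A j a) ∈ algPow A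
    rw [bigShift_bigSite]
    exact StarAlgebra.subset_adjoin ℂ _ (Set.mem_iUnion.2 ⟨j + k, a, rfl⟩)
  exact this hx

/-- The shift by `k` sites to the right on the algebraic tensor power. -/
noncomputable def algShift (k : ℤ) : AlgPow A →⋆ₐ[ℂ] AlgPow A :=
  ((bigShift A k).comp (algPow A).subtype).codRestrict (algPow A)
    (fun x => bigShift_mem A k x.2)

lemma algShift_algSite (k j : ℤ) (a : A) : algShift A k (algSite A j a) = algSite A (j + k) a :=
  Subtype.ext (bigShift_bigSite A k j a)

lemma algShift_algShift (k l : ℤ) (x : AlgPow A) :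
    algShift A k (algShift A l x) = algShift A (l + k) x := by
  induction x using algPow_induction with
  | site j a => rw [algShift_algSite, algShift_algSite, algShift_algSite, add_assoc]
  | scalar r => rw [AlgHomClass.commutes, AlgHomClass.commutes, AlgHomClass.commutes]
  | add x y hx hy => simp only [map_add, hx, hy]
  | mul x y hx hy => simp only [map_mul, hx, hy]
  | hstar x hx => simp only [map_star, hx]

lemma algShift_zero (x : AlgPow A) : algShift A 0 x = x := by
  induction x using algPow_induction with
  | site j a => rw [algShift_algSite, add_zero]
  | scalar r => rw [AlgHomClass.commutes]
  | add x y hx hy => simp only [map_add, hx, hy]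
  | mul x y hx hy => simp only [map_mul, hx, hy]
  | hstar x hx => simp only [map_star, hx]

lemma uniformContinuous_algShift (k : ℤ) : UniformContinuous (algShift A k) :=
  (AddMonoidHomClass.lipschitz_of_bound (algShift A k) 1 (fun x => by
    rw [one_mul]; exact norm_endo_le _ x)).uniformContinuous

/-- The shift by `k` sites to the right, as a map on `A^{⊗ℤ}`. -/
noncomputable def shiftFun (k : ℤ) : AZ A → AZ A := Completion.map (algShift A k)

lemma shiftFun_toAZ (k : ℤ) (x : AlgPow A) :
    shiftFun A k (toAZ A x) = toAZ A (algShift A k x) :=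
  Completion.map_coe (uniformContinuous_algShift A k) x

lemma continuous_shiftFun (k : ℤ) : Continuous (shiftFun A k) := Completion.continuous_map

lemma shiftFun_shiftFun (k l : ℤ) (x : AZ A) :
    shiftFun A k (shiftFun A l x) = shiftFun A (l + k) x := by
  refine denseRange_toAZ.induction_on
    (p := fun x : AZ A => shiftFun A k (shiftFun A l x) = shiftFun A (l + k) x) x
    (isClosed_eq ((continuous_shiftFun A k).comp (continuous_shiftFun A l))
      (continuous_shiftFun A _)) fun y => ?_
  rw [shiftFun_toAZ, shiftFun_toAZ, shiftFun_toAZ, algShift_algShift]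

lemma shiftFun_zero (x : AZ A) : shiftFun A 0 x = x := by
  refine denseRange_toAZ.induction_on (p := fun x : AZ A => shiftFun A 0 x = x) x
    (isClosed_eq (continuous_shiftFun A 0) continuous_id) fun y => ?_
  rw [shiftFun_toAZ, algShift_zero]

/-- The shift automorphism `S (⊗ aₙ) = ⊗ aₙ₋₁` of `A^{⊗ℤ}`. -/
noncomputable def shift : AZ A ≃⋆ₐ[ℂ] AZ A where
  toFun := shiftFun A 1
  invFun := shiftFun A (-1)
  left_inv x := by rw [shiftFun_shiftFun, add_neg_cancel, shiftFun_zero]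
  right_inv x := by rw [shiftFun_shiftFun, neg_add_cancel, shiftFun_zero]
  map_mul' x y := by
    refine denseRange_toAZ.induction_on₂
      (p := fun x y : AZ A => shiftFun A 1 (x * y) = shiftFun A 1 x * shiftFun A 1 y)
      (isClosed_eq ((continuous_shiftFun A 1).comp continuous_mul)
        (((continuous_shiftFun A 1).comp continuous_fst).mul
          ((continuous_shiftFun A 1).comp continuous_snd))) (fun x y => ?_) x y
    rw [← toAZ_mul, shiftFun_toAZ, map_mul, toAZ_mul, shiftFun_toAZ, shiftFun_toAZ]
  map_add' x y := by
    refine denseRange_toAZ.induction_on₂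
      (p := fun x y : AZ A => shiftFun A 1 (x + y) = shiftFun A 1 x + shiftFun A 1 y)
      (isClosed_eq ((continuous_shiftFun A 1).comp continuous_add)
        (((continuous_shiftFun A 1).comp continuous_fst).add
          ((continuous_shiftFun A 1).comp continuous_snd))) (fun x y => ?_) x y
    rw [← toAZ_add, shiftFun_toAZ, map_add, toAZ_add, shiftFun_toAZ, shiftFun_toAZ]
  map_star' x := by
    refine denseRange_toAZ.induction_on
      (p := fun x : AZ A => shiftFun A 1 (star x) = star (shiftFun A 1 x)) x
      (isClosed_eq ((continuous_shiftFun A 1).comp continuous_star_AZ)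
        (continuous_star_AZ.comp (continuous_shiftFun A 1))) fun y => ?_
    rw [star_toAZ, shiftFun_toAZ, map_star, shiftFun_toAZ, star_toAZ]
  map_smul' r x := by
    refine denseRange_toAZ.induction_on
      (p := fun x : AZ A => shiftFun A 1 (r • x) = r • shiftFun A 1 x) x
      (isClosed_eq ((continuous_shiftFun A 1).comp (continuous_const_smul r))
        ((continuous_const_smul r).comp (continuous_shiftFun A 1))) fun y => ?_
    rw [← toAZ_smul, shiftFun_toAZ, map_smul, toAZ_smul, shiftFun_toAZ]

lemma continuous_shift : Continuous (shift A) := continuous_shiftFun A 1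

/-- `S` moves the site `j` to the site `j + 1`. -/
lemma shift_site (j : ℤ) (a : A) : shift A (site A j a) = site A (j + 1) a := by
  change shiftFun A 1 (toAZ A (algSite A j a)) = toAZ A (algSite A (j + 1) a)
  rw [shiftFun_toAZ, algShift_algSite]

end Shift

section Regions

variable (A : Type u) [CStarAlgebra A]

/-- The `C⋆`-subalgebra of `A^{⊗ℤ}` generated by the copies of `A` at the sites in `s`. -/
noncomputable def region (s : Set ℤ) : StarSubalgebra ℂ (AZ A) :=
  (StarAlgebra.adjoin ℂ (⋃ j ∈ s, Set.range (site A j))).topologicalClosure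

lemma isClosed_region (s : Set ℤ) : IsClosed (region A s : Set (AZ A)) :=
  StarSubalgebra.isClosed_topologicalClosure _

noncomputable instance (s : Set ℤ) : CStarAlgebra (region A s) :=
  StarSubalgebra.cstarAlgebra (h_closed := isClosed_region A s) (region A s)

lemma site_mem_region {s : Set ℤ} {j : ℤ} (hj : j ∈ s) (a : A) : site A j a ∈ region A s :=
  StarSubalgebra.le_topologicalClosure _
    (StarAlgebra.subset_adjoin ℂ _ (Set.mem_biUnion hj ⟨a, rfl⟩))

lemma region_le {s : Set ℤ} {T : StarSubalgebra ℂ (AZ A)} (hT : IsClosed (T : Set (AZ A)))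
    (h : ∀ j ∈ s, ∀ a, site A j a ∈ T) : region A s ≤ T := by
  refine StarSubalgebra.topologicalClosure_minimal (StarAlgebra.adjoin_le ?_) hT
  intro x hx
  obtain ⟨j, hj, a, rfl⟩ := Set.mem_iUnion₂.1 hx
  exact h j hj a

lemma site_commute {i j : ℤ} (h : i ≠ j) (a b : A) : Commute (site A i a) (site A j b) :=
  (algSite_commute A h a b).map (toAZHom A)

/-- The algebras of disjoint regions commute. -/
lemma region_commute {s t : Set ℤ} (hst : Disjoint s t) {x y : AZ A} (hx : x ∈ region A s)
    (hy : y ∈ region A t) : Commute x y := by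
  have closed : ∀ u : Set (AZ A),
      IsClosed (StarSubalgebra.centralizer ℂ u : Set (AZ A)) := fun u => by
    rw [StarSubalgebra.coe_centralizer]
    exact Set.isClosed_centralizer _
  have h1 : ∀ i ∈ s, ∀ a, region A t ≤ StarSubalgebra.centralizer ℂ {site A i a} := by
    intro i hi a
    refine region_le A (closed _) fun j hj b => ?_
    rw [StarSubalgebra.mem_centralizer_iff]
    have hij : i ≠ j := fun h => Set.disjoint_left.1 hst hi (h ▸ hj)
    rintro _ rfl
    refine ⟨site_commute A hij a b, ?_⟩
    rw [← map_star]
    exact site_commute A hij (star a) b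
  have h2 : region A s ≤ StarSubalgebra.centralizer ℂ {y} := by
    refine region_le A (closed _) fun i hi a => ?_
    rw [StarSubalgebra.mem_centralizer_iff]
    rintro _ rfl
    have h3 := (StarSubalgebra.mem_centralizer_iff ℂ).1 (h1 i hi a hy) _ rfl
    refine ⟨h3.1.symm, ?_⟩
    have h4 := (StarSubalgebra.mem_centralizer_iff ℂ).1
      (h1 i hi a (star_mem hy)) _ rfl
    exact h4.1.symm
  exact (((StarSubalgebra.mem_centralizer_iff ℂ).1 (h2 hx)) y rfl).1.symm

/-- `S` maps the algebra of a region into the algebra of the translated region. -/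
lemma shift_mem_region {s t : Set ℤ} (hst : ∀ j ∈ s, j + 1 ∈ t) {x : AZ A}
    (hx : x ∈ region A s) : shift A x ∈ region A t := by
  have : region A s ≤ (region A t).comap (shift A : AZ A →⋆ₐ[ℂ] AZ A) := by
    refine region_le A ((isClosed_region A t).preimage (continuous_shift A)) fun j hj a => ?_
    change shift A (site A j a) ∈ region A t
    rw [shift_site]
    exact site_mem_region A (hst j hj) a
  exact this hx

lemma region_mono {s t : Set ℤ} (hst : s ⊆ t) : region A s ≤ region A t :=
  region_le A (isClosed_region A t) fun _ hj a => site_mem_region A (hst hj) a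

/-- The right half `A_R`, generated by the sites `n ≥ 1`. -/
abbrev AR : Type u := region A (Set.Ici 1)

/-- The left half `A_L`, generated by the sites `n ≤ 0`. -/
abbrev AL : Type u := region A (Set.Iic 0)

/-- `ξ_R (a ⊗ a_R) = S (α₀⁻¹(a) ⊗ a_R)`: put `a` in front of `a_R` and shift to the right. -/
noncomputable def xiR (a : A) (r : AR A) : AR A :=
  ⟨shift A (site A 0 a * (r : AZ A)), shift_mem_region A (s := Set.Ici 0)
    (fun j hj => by simp only [Set.mem_Ici] at hj ⊢; omega)
    (mul_mem (site_mem_region A (by simp) a)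
      (region_mono A (Set.Ici_subset_Ici.2 zero_le_one) r.2))⟩

end Regions

section Positivity

open Matrix

variable {D : Type u} [CStarAlgebra D]

/-- Positivity of a matrix over a `C⋆`-algebra: `M = Y⋆ Y` for some matrix `Y` of the same size. -/
def MatPos {ι : Type*} [Fintype ι] (M : Matrix ι ι D) : Prop :=
  ∃ Y : Matrix ι ι D, M = Yᴴ * Y

attribute [local instance] CStarAlgebra.spectralOrder CStarAlgebra.spectralOrderedRing

lemma nonneg_iff_star_mul_self {E : Type*} [NonUnitalCStarAlgebra E] [PartialOrder E]
    [StarOrderedRing E] (M : E) : 0 ≤ M ↔ ∃ Y : E, M = star Y * Y :=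
  CStarAlgebra.nonneg_iff_eq_star_mul_self

lemma matPos_iff {ι : Type*} [Fintype ι] (M : Matrix ι ι D) :
    MatPos M ↔ 0 ≤ CStarMatrix.ofMatrix M := by
  rw [nonneg_iff_star_mul_self]
  exact ⟨fun ⟨Y, hY⟩ => ⟨CStarMatrix.ofMatrix Y, hY⟩, fun ⟨Y, hY⟩ => ⟨Y, hY⟩⟩

lemma MatPos.add {ι : Type*} [Fintype ι] {M N : Matrix ι ι D} (hM : MatPos M) (hN : MatPos N) :
    MatPos (M + N) := by
  rw [matPos_iff] at *
  exact add_nonneg hM hN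

lemma MatPos.zero {ι : Type*} [Fintype ι] : MatPos (0 : Matrix ι ι D) := ⟨0, by simp⟩

lemma MatPos.sum {ι κ : Type*} [Fintype ι] (s : Finset κ) {M : κ → Matrix ι ι D}
    (h : ∀ k ∈ s, MatPos (M k)) : MatPos (∑ k ∈ s, M k) := by
  classical
  induction s using Finset.induction_on with
  | empty => simpa using MatPos.zero
  | insert a s ha ih =>
    rw [Finset.sum_insert ha]
    exact (h a (by simp)).add (ih fun k hk => h k (by simp [hk]))

lemma matPos_gram {ι κ : Type*} [Fintype ι] [Fintype κ] (W : Matrix ι κ D) :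
    MatPos (Wᴴ * W) := by
  classical
  rcases isEmpty_or_nonempty κ with h | ⟨⟨k₀⟩⟩
  · exact ⟨0, Subsingleton.elim _ _⟩
  · have : Wᴴ * W = ∑ i, (Matrix.of fun k l => if k = k₀ then W i l else 0 : Matrix κ κ D)ᴴ
        * (Matrix.of fun k l => if k = k₀ then W i l else 0 : Matrix κ κ D) := by
      ext k l
      simp [Matrix.sum_apply, Matrix.mul_apply, apply_ite star]
    rw [this]
    exact MatPos.sum _ fun i _ => ⟨_, rfl⟩

lemma MatPos.conj {ι κ : Type*} [Fintype ι] [Fintype κ] {M : Matrix ι ι D} (hM : MatPos M)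
    (Z : Matrix ι κ D) : MatPos (Zᴴ * M * Z) := by
  obtain ⟨Y, rfl⟩ := hM
  have : Zᴴ * (Yᴴ * Y) * Z = (Y * Z)ᴴ * (Y * Z) := by
    rw [Matrix.conjTranspose_mul]; simp only [Matrix.mul_assoc]
  rw [this]
  exact matPos_gram _

/-- A self-adjoint matrix is dominated by a multiple of the unit. -/
lemma exists_matPos_smul_one_add {ι : Type*} [Fintype ι] [DecidableEq ι] {H : Matrix ι ι D}
    (hH : Hᴴ = H) : ∃ c : ℝ, 0 ≤ c ∧ MatPos ((c : ℂ) • (1 : Matrix ι ι D) + H) := by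
  have hs : IsSelfAdjoint (CStarMatrix.ofMatrix H) := hH
  refine ⟨‖CStarMatrix.ofMatrix H‖, norm_nonneg _, ?_⟩
  rw [matPos_iff]
  have := hs.neg_algebraMap_norm_le_self
  rw [neg_le_iff_add_nonneg'] at this
  rw [IsScalarTower.algebraMap_apply ℝ ℂ, Algebra.algebraMap_eq_smul_one] at this
  exact this

lemma matPos_smul_one {ι : Type*} [Fintype ι] [DecidableEq ι] {c : ℝ} (hc : 0 ≤ c) :
    MatPos ((c : ℂ) • (1 : Matrix ι ι D)) := by
  refine ⟨((Real.sqrt c : ℝ) : ℂ) • 1, ?_⟩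
  rw [conjTranspose_smul, conjTranspose_one, smul_mul_smul_comm, one_mul]
  congr 1
  simp [← Complex.ofReal_mul, Real.mul_self_sqrt hc]

end Positivity

section Reduction

open Matrix

/-- A state on a unital `C⋆`-algebra. -/
structure State (D : Type u) [CStarAlgebra D] where
  /-- the underlying bounded linear functional -/
  toCLM : D →L[ℂ] ℂ
  map_one' : toCLM 1 = 1
  nonneg' : ∀ x, 0 ≤ toCLM (star x * x)

lemma State.map_star {D : Type u} [CStarAlgebra D] (ω : State D) (x : D) :
    ω.toCLM (star x) = star (ω.toCLM x) := by
  have h1 := (Complex.nonneg_iff.1 (ω.nonneg' (1 + x))).2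
  have h2 := (Complex.nonneg_iff.1 (ω.nonneg' (1 + Complex.I • x))).2
  have h3 := (Complex.nonneg_iff.1 (ω.nonneg' x)).2
  have e1 : star (1 + x) * (1 + x) = 1 + x + star x + star x * x := by
    simp [mul_add, add_mul]; abel
  have e2 : star (1 + Complex.I • x) * (1 + Complex.I • x)
      = 1 + Complex.I • x - Complex.I • star x + star x * x := by
    simp [mul_add, add_mul, smul_smul]; abel
  rw [e1] at h1
  rw [e2] at h2
  simp only [map_add, map_sub, map_smul, ω.map_one', Complex.add_im, Complex.sub_im, smul_eq_mul,
    Complex.one_im, Complex.mul_im, Complex.I_re, Complex.I_im] at h1 h2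
  apply Complex.ext
  · simp; linarith
  · simp; linarith

variable {A : Type u} [CStarAlgebra A] (ω : State (AZ A))

/-- The entanglement kernel `⋂_{x ∈ A_L} Ker ω_x`, where `ω_x (a_R) = ω (x a_R)`. -/
def entKernel : Submodule ℂ (AR A) where
  carrier := {r | ∀ x : AL A, ω.toCLM ((x : AZ A) * (r : AZ A)) = 0}
  zero_mem' := fun x => by simp
  add_mem' := fun {r s} hr hs x => by
    have h1 := hr x
    have h2 := hs x
    simp only [AddMemClass.coe_add, mul_add, map_add, h1, h2, add_zero]
  smul_mem' := fun c r hr x => by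
    have h1 := hr x
    change ω.toCLM ((x : AZ A) * (c • (r : AZ A))) = 0
    rw [mul_smul_comm, map_smul, h1, smul_zero]

lemma star_mem_entKernel {r : AR A} (hr : r ∈ entKernel ω) : star r ∈ entKernel ω := fun x => by
  have hc : Commute (x : AZ A) (star (r : AZ A)) :=
    region_commute A (s := Set.Iic 0) (t := Set.Ici 1)
      (Set.disjoint_left.2 fun j h1 h2 => by
        simp only [Set.mem_Iic, Set.mem_Ici] at h1 h2; omega) x.2 (star_mem r.2)
  have h := hr (star x)
  change ω.toCLM ((x : AZ A) * star (r : AZ A)) = 0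
  rw [hc.eq, ← star_star (x : AZ A), ← star_mul, ω.map_star]
  change star (ω.toCLM (star (x : AZ A) * (r : AZ A))) = 0
  have h' : ω.toCLM (star (x : AZ A) * (r : AZ A)) = 0 := h
  rw [h', star_zero]

/-- The reduced space `B_ω = A_R / K_ω`. -/
def B : Type u := AR A ⧸ entKernel ω

noncomputable instance : AddCommGroup (B ω) := inferInstanceAs (AddCommGroup (AR A ⧸ entKernel ω))
noncomputable instance : Module ℂ (B ω) := inferInstanceAs (Module ℂ (AR A ⧸ entKernel ω))

/-- The quotient map `a_R ↦ ⌊a_R⌋`. -/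
noncomputable def cls : AR A →ₗ[ℂ] B ω := (entKernel ω).mkQ

lemma cls_surjective : Function.Surjective (cls ω) := (entKernel ω).mkQ_surjective

/-- The unit `e = ⌊1⌋` of `B_ω`. -/
noncomputable def unitB : B ω := cls ω 1

/-- The involution `⌊a⌋⋆ = ⌊a⋆⌋` of `B_ω`, as a conjugate-linear map. -/
noncomputable def starB : B ω →ₗ⋆[ℂ] B ω :=
  (entKernel ω).mapQ (entKernel ω) ((starLinearEquiv ℂ : AR A ≃ₗ⋆[ℂ] AR A) : AR A →ₗ⋆[ℂ] AR A)
    (fun _ hr => star_mem_entKernel ω hr)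

lemma starB_cls (r : AR A) : starB ω (cls ω r) = cls ω (star r) := rfl

noncomputable instance : StarAddMonoid (B ω) where
  star := starB ω
  star_involutive x := by
    obtain ⟨r, rfl⟩ := cls_surjective ω x
    rw [starB_cls, starB_cls, star_star]
  star_add x y := map_add _ x y

lemma star_cls (r : AR A) : star (cls ω r) = cls ω (star r) := rfl

instance : StarModule ℂ (B ω) where
  star_smul c x := (starB ω).map_smulₛₗ c x

/-- The cones `C_n` of the Archimedean matrix order of `B_ω`: the matrix of classes `[⌊a_ij⌋]` is in
the cone if for every `ε > 0` there are representatives such that `ε 1 + [a_ij]` is positive. -/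
def cone (ι : Type*) [Fintype ι] [DecidableEq ι] : Set (Matrix ι ι (B ω)) :=
  {M | ∀ ε : ℝ, 0 < ε → ∃ X : Matrix ι ι (AR A),
    X.map (cls ω) = M ∧ MatPos ((ε : ℂ) • (1 : Matrix ι ι (AR A)) + X)}

/-- The matrix norms determined by the matrix order and the matrix order unit:
`‖x‖ = inf {r ≥ 0 | [[r e, x], [x⋆, r e]] ≥ 0}`. -/
noncomputable def osyNorm {m n : Type*} [Fintype m] [Fintype n] [DecidableEq m] [DecidableEq n]
    (x : Matrix m n (B ω)) : ℝ :=
  sInf {r : ℝ | 0 ≤ r ∧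
    Matrix.fromBlocks (Matrix.diagonal fun _ => (r : ℂ) • unitB ω) x
      xᴴ (Matrix.diagonal fun _ => (r : ℂ) • unitB ω) ∈ cone ω (m ⊕ n)}

variable {ω}

lemma cone_add {ι : Type*} [Fintype ι] [DecidableEq ι] {M N : Matrix ι ι (B ω)}
    (hM : M ∈ cone ω ι) (hN : N ∈ cone ω ι) : M + N ∈ cone ω ι := fun ε hε => by
  obtain ⟨X, hX, hX'⟩ := hM (ε / 2) (by positivity)
  obtain ⟨Y, hY, hY'⟩ := hN (ε / 2) (by positivity)
  refine ⟨X + Y, ?_, ?_⟩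
  · rw [← hX, ← hY]; ext i j; simp
  · convert hX'.add hY' using 1
    rw [add_add_add_comm, ← add_smul, ← Complex.ofReal_add, add_halves]

/-- The cones are stable under conjugation with scalar matrices. -/
lemma cone_conj {ι κ : Type*} [Fintype ι] [DecidableEq ι] [Fintype κ] [DecidableEq κ]
    {M : Matrix ι ι (B ω)} (hM : M ∈ cone ω ι) (Z : Matrix ι κ ℂ) :
    (Matrix.of fun k l => ∑ i, ∑ j, (star (Z i k) * Z j l) • M i j) ∈ cone ω κ := fun ε hε => by
  let Z' : Matrix ι κ (AR A) := Z.map (algebraMap ℂ (AR A))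
  obtain ⟨c, hc0, hc⟩ := exists_matPos_smul_one_add (H := -(Z'ᴴ * Z'))
    (by rw [conjTranspose_neg, conjTranspose_mul, conjTranspose_conjTranspose])
  have hδ : 0 < ε / (c + 1) := by positivity
  set δ := ε / (c + 1) with hδ'
  obtain ⟨X, hX, hX'⟩ := hM δ hδ
  refine ⟨Z'ᴴ * X * Z', ?_, ?_⟩
  · ext k l
    rw [← hX]
    simp only [Matrix.map_apply, Matrix.mul_apply, Matrix.conjTranspose_apply, map_sum,
      Finset.sum_mul, Matrix.of_apply, ← map_smul]
    rw [Finset.sum_comm]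
    refine Finset.sum_congr rfl fun i _ => Finset.sum_congr rfl fun j _ => ?_
    congr 1
    simp only [Z', Matrix.map_apply, Algebra.algebraMap_eq_smul_one, star_smul, star_one,
      smul_mul_assoc, one_mul, mul_smul_comm, mul_one, smul_smul]
    rw [mul_comm]
  · have h1 := hX'.conj Z'
    have h2 : MatPos ((δ : ℂ) • ((c : ℂ) • (1 : Matrix κ κ (AR A)) + -(Z'ᴴ * Z'))) := by
      have := hc.conj (((Real.sqrt δ : ℝ) : ℂ) • (1 : Matrix κ κ (AR A)))
      convert this using 1
      rw [conjTranspose_smul, conjTranspose_one, smul_mul_assoc, one_mul, mul_smul_comm, mul_one,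
        smul_smul]
      congr 1
      simp [← Complex.ofReal_mul, Real.mul_self_sqrt hδ.le]
    have h3 : MatPos ((δ : ℂ) • (1 : Matrix κ κ (AR A))) := matPos_smul_one hδ.le
    convert (h1.add h2).add h3 using 1
    have hε' : (ε : ℂ) = δ * c + δ := by
      rw [← Complex.ofReal_mul, ← Complex.ofReal_add]
      congr 1
      rw [hδ']
      field_simp
    rw [hε']
    simp only [Matrix.mul_add, Matrix.add_mul, smul_add, smul_neg, add_smul, smul_smul]
    simp only [Matrix.mul_smul, Matrix.smul_mul, Matrix.mul_one]
    abel

end Reduction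

section OrderNorm

open Matrix

variable {A : Type u} [CStarAlgebra A] {ω : State (AZ A)}
variable {m n m' : Type*} [Fintype m] [Fintype n] [DecidableEq m] [DecidableEq n]
  [Fintype m'] [DecidableEq m']

variable (ω) in
/-- `[[a e, x], [x⋆, b e]] ≥ 0`. -/
def Adm (a b : ℝ) (x : Matrix m n (B ω)) : Prop :=
  Matrix.fromBlocks (Matrix.diagonal fun _ => (a : ℂ) • unitB ω) x
    xᴴ (Matrix.diagonal fun _ => (b : ℂ) • unitB ω) ∈ cone ω (m ⊕ n)

lemma osyNorm_nonneg (x : Matrix m n (B ω)) : 0 ≤ osyNorm ω x :=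
  Real.sInf_nonneg fun _ h => h.1

lemma osyNorm_le {x : Matrix m n (B ω)} {r : ℝ} (hr : 0 ≤ r) (h : Adm ω r r x) :
    osyNorm ω x ≤ r :=
  csInf_le ⟨0, fun _ h => h.1⟩ ⟨hr, h⟩

lemma exists_adm (x : Matrix m n (B ω)) : ∃ r : ℝ, 0 ≤ r ∧ Adm ω r r x := by
  choose X hX using fun i j => cls_surjective ω (x i j)
  let X' : Matrix m n (AR A) := Matrix.of X
  obtain ⟨c, hc, h⟩ := exists_matPos_smul_one_add (D := AR A)
    (H := Matrix.fromBlocks 0 X' X'ᴴ 0) (by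
      rw [Matrix.fromBlocks_conjTranspose]; simp)
  refine ⟨c, hc, fun ε hε => ⟨(c : ℂ) • 1 + Matrix.fromBlocks 0 X' X'ᴴ 0, ?_,
    (matPos_smul_one hε.le).add h⟩⟩
  ext (i | i) (j | j)
  · by_cases hij : i = j
    · subst hij; simp [unitB]
    · simp [hij]
  · simp [X', hX]
  · simp [X', ← star_cls, hX]
  · by_cases hij : i = j
    · subst hij; simp [unitB]
    · simp [hij]

lemma exists_adm_lt {x : Matrix m n (B ω)} {r : ℝ} (h : osyNorm ω x < r) :
    ∃ s, 0 ≤ s ∧ s < r ∧ Adm ω s s x := by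
  obtain ⟨s, ⟨h0, hs⟩, hsr⟩ := exists_lt_of_csInf_lt (s := {r : ℝ | 0 ≤ r ∧ Adm ω r r x})
    (exists_adm x) h
  exact ⟨s, h0, hsr, hs⟩

lemma Adm.add {a b a' b' : ℝ} {x y : Matrix m n (B ω)} (hx : Adm ω a b x)
    (hy : Adm ω a' b' y) : Adm ω (a + a') (b + b') (x + y) := by
  have := cone_add hx hy
  rw [Matrix.fromBlocks_add] at this
  unfold Adm
  convert this using 2 <;>
    simp [Matrix.diagonal_add, add_smul, Matrix.conjTranspose_add]

/-- Conjugation with a scalar block diagonal matrix. -/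
lemma Adm.conj {a b : ℝ} {x : Matrix m n (B ω)} (hx : Adm ω a b x) (s t : ℂ) :
    Adm ω (‖s‖ ^ 2 * a) (‖t‖ ^ 2 * b) ((star s * t) • x) := by
  have := cone_conj hx (Matrix.diagonal (Sum.elim (fun _ => s) (fun _ => t)))
  unfold Adm
  convert this using 1
  have hn : ∀ z : ℂ, star z * z = ((‖z‖ ^ 2 : ℝ) : ℂ) := fun z => by
    rw [Complex.star_def, Complex.conj_mul']; simp
  ext k l
  have key : ∀ (d : m ⊕ n → ℂ) (M : Matrix (m ⊕ n) (m ⊕ n) (B ω)),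
      (∑ i, ∑ j, (star (Matrix.diagonal d i k) * Matrix.diagonal d j l) • M i j)
        = (star (d k) * d l) • M k l := fun d M => by
    rw [Finset.sum_eq_single k, Finset.sum_eq_single l]
    · simp
    · intro j _ hj; simp [hj]
    · simp
    · intro i _ hi
      refine Finset.sum_eq_zero fun j _ => ?_
      simp [hi]
    · simp
  rw [Matrix.of_apply, key]
  rcases k with k | k <;> rcases l with l | l
  · by_cases h : k = l
    · subst h
      simp only [Matrix.fromBlocks_apply₁₁, Matrix.diagonal_apply_eq, Sum.elim_inl, hn, smul_smul]
      push_cast; rfl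
    · simp [h]
  · simp
  · simp [mul_comm]
  · by_cases h : k = l
    · subst h
      simp only [Matrix.fromBlocks_apply₂₂, Matrix.diagonal_apply_eq, Sum.elim_inr, hn, smul_smul]
      push_cast; rfl
    · simp [h]

/-- Stacking two matrices. -/
lemma Adm.stack {a b b' : ℝ} {x : Matrix m n (B ω)} {y : Matrix m' n (B ω)}
    (hx : Adm ω a b x) (hy : Adm ω a b' y) :
    Adm ω a (b + b') (Matrix.of (Sum.elim x y) : Matrix (m ⊕ m') n (B ω)) := by
  have h1 := cone_conj hx (Matrix.of fun (i : m ⊕ n) (k : (m ⊕ m') ⊕ n) =>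
    if Sum.map Sum.inl id i = k then (1 : ℂ) else 0)
  have h2 := cone_conj hy (Matrix.of fun (i : m' ⊕ n) (k : (m ⊕ m') ⊕ n) =>
    if Sum.map Sum.inr id i = k then (1 : ℂ) else 0)
  have := cone_add h1 h2
  unfold Adm
  convert this using 1
  ext ((k | k) | k) ((l | l) | l) <;>
    simp [Fintype.sum_sum_type, Matrix.diagonal_apply, apply_ite star, add_smul, ite_smul]
  any_goals rfl
  split_ifs <;> simp

lemma Adm.reindex {a b : ℝ} {x : Matrix m n (B ω)} (hx : Adm ω a b x) (e : m' ≃ m) :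
    Adm ω a b (x.submatrix e id) := fun ε hε => by
  obtain ⟨X, hX, Y, hY⟩ := hx ε hε
  let f : m' ⊕ n ≃ m ⊕ n := Equiv.sumCongr e (Equiv.refl n)
  refine ⟨X.submatrix f f, ?_, Y.submatrix f f, ?_⟩
  · have := congrArg (fun M => M.submatrix f f) hX
    simp only [Matrix.submatrix_map] at this
    rw [this]
    ext (i | i) (j | j) <;> simp [f, Matrix.diagonal_apply]
  · have := congrArg (fun M => M.submatrix f f) hY
    rw [← Matrix.submatrix_mul_equiv (e₂ := f)] at this
    rw [Matrix.conjTranspose_submatrix, ← this]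
    ext i j
    simp [Matrix.one_apply]

lemma Adm.zero {a b : ℝ} (ha : 0 ≤ a) (hb : 0 ≤ b) : Adm ω a b (0 : Matrix m n (B ω)) := by
  intro ε hε
  refine ⟨Matrix.diagonal (Sum.elim (fun _ => (a : ℂ) • 1) (fun _ => (b : ℂ) • 1)), ?_, ?_⟩
  · ext (i | i) (j | j)
    · by_cases hij : i = j
      · subst hij; simp [unitB]
      · simp [hij]
    · simp
    · simp
    · by_cases hij : i = j
      · subst hij; simp [unitB]
      · simp [hij]
  · have hsq : ∀ c : ℝ, 0 ≤ c → star (((Real.sqrt (ε + c) : ℝ) : ℂ) • (1 : AR A))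
        * (((Real.sqrt (ε + c) : ℝ) : ℂ) • (1 : AR A)) = (ε : ℂ) • 1 + (c : ℂ) • 1 :=
      fun c hc => by
        rw [star_smul, star_one, smul_mul_smul_comm, one_mul, ← add_smul]
        congr 1
        simp [← Complex.ofReal_mul, ← Complex.ofReal_add,
          Real.mul_self_sqrt (add_nonneg hε.le hc)]
    refine ⟨Matrix.diagonal (Sum.elim (fun _ => ((Real.sqrt (ε + a) : ℝ) : ℂ) • 1)
      (fun _ => ((Real.sqrt (ε + b) : ℝ) : ℂ) • 1)), ?_⟩
    rw [Matrix.diagonal_conjTranspose, Matrix.diagonal_mul_diagonal, ← Matrix.diagonal_one,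
      ← Matrix.diagonal_smul, Matrix.diagonal_add]
    congr 1
    funext i
    rcases i with i | i
    · exact (hsq a ha).symm
    · exact (hsq b hb).symm

/-- Every `α > ‖x‖` is admissible. -/
lemma adm_of_lt {x : Matrix m n (B ω)} {α : ℝ} (h : osyNorm ω x < α) : Adm ω α α x := by
  obtain ⟨s, _, hs, hx⟩ := exists_adm_lt h
  have := hx.add (Adm.zero (sub_nonneg.2 hs.le) (sub_nonneg.2 hs.le))
  simpa using this

lemma osyNorm_add_le (x y : Matrix m n (B ω)) :
    osyNorm ω (x + y) ≤ osyNorm ω x + osyNorm ω y := by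
  refine le_of_forall_pos_le_add fun ε hε => ?_
  obtain ⟨s, hs0, hs, hx⟩ := exists_adm_lt (lt_add_of_pos_right (osyNorm ω x) (half_pos hε))
  obtain ⟨t, ht0, ht, hy⟩ := exists_adm_lt (lt_add_of_pos_right (osyNorm ω y) (half_pos hε))
  have := osyNorm_le (add_nonneg hs0 ht0) (hx.add hy)
  linarith

lemma osyNorm_smul_le (c : ℂ) (x : Matrix m n (B ω)) :
    osyNorm ω (c • x) ≤ ‖c‖ * osyNorm ω x := by
  refine le_of_forall_pos_le_add fun ε hε => ?_
  have hc1 : 0 < ‖c‖ + 1 := by positivity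
  obtain ⟨r, hr0, hr, hx⟩ := exists_adm_lt (lt_add_of_pos_right (osyNorm ω x) (div_pos hε hc1))
  have h := hx.conj ((Real.sqrt ‖c‖ : ℝ) : ℂ) (c / ((Real.sqrt ‖c‖ : ℝ) : ℂ))
  have e1 : star ((Real.sqrt ‖c‖ : ℝ) : ℂ) * (c / ((Real.sqrt ‖c‖ : ℝ) : ℂ)) = c := by
    rw [Complex.star_def, Complex.conj_ofReal]
    rcases eq_or_ne c 0 with rfl | hc
    · simp
    · have : ((Real.sqrt ‖c‖ : ℝ) : ℂ) ≠ 0 := by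
        rw [Complex.ofReal_ne_zero, Real.sqrt_ne_zero']; exact norm_pos_iff.2 hc
      field_simp
  have e2 : ‖((Real.sqrt ‖c‖ : ℝ) : ℂ)‖ ^ 2 = ‖c‖ := by
    rw [Complex.norm_real, Real.norm_of_nonneg (Real.sqrt_nonneg _), Real.sq_sqrt (norm_nonneg _)]
  have e3 : ‖c / ((Real.sqrt ‖c‖ : ℝ) : ℂ)‖ ^ 2 = ‖c‖ := by
    rw [norm_div, div_pow, e2]
    rcases eq_or_ne c 0 with rfl | hc
    · simp
    · have : ‖c‖ ≠ 0 := norm_ne_zero_iff.2 hc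
      field_simp
  rw [e1, e2, e3] at h
  have h' := osyNorm_le (mul_nonneg (norm_nonneg _) hr0) h
  calc osyNorm ω (c • x) ≤ ‖c‖ * r := h'
    _ ≤ ‖c‖ * (osyNorm ω x + ε / (‖c‖ + 1)) := by gcongr
    _ = ‖c‖ * osyNorm ω x + ‖c‖ / (‖c‖ + 1) * ε := by ring
    _ ≤ ‖c‖ * osyNorm ω x + 1 * ε := by
      gcongr
      rw [div_le_one hc1]
      linarith
    _ = ‖c‖ * osyNorm ω x + ε := by ring

lemma Adm.scale {z : Matrix m n (B ω)} {γ T : ℝ} (hγ : 0 < γ) (hT0 : 0 < T)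
    (hz : Adm ω γ γ z) : Adm ω T (γ ^ 2 / T) z := by
  have h := hz.conj ((Real.sqrt (T / γ) : ℝ) : ℂ) ((Real.sqrt (γ / T) : ℝ) : ℂ)
  have e1 : star ((Real.sqrt (T / γ) : ℝ) : ℂ) * ((Real.sqrt (γ / T) : ℝ) : ℂ) = 1 := by
    rw [Complex.star_def, Complex.conj_ofReal, ← Complex.ofReal_mul,
      ← Real.sqrt_mul (by positivity)]
    have : T / γ * (γ / T) = 1 := by field_simp
    rw [this]; simp
  have e2 : ∀ c : ℝ, 0 ≤ c → ‖((Real.sqrt c : ℝ) : ℂ)‖ ^ 2 = c := fun c hc => by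
    rw [Complex.norm_real, Real.norm_of_nonneg (Real.sqrt_nonneg _), Real.sq_sqrt hc]
  rw [e1, e2 _ (by positivity), e2 _ (by positivity), one_smul] at h
  convert h using 1 <;> field_simp

lemma osyNorm_stack_le {x : Matrix m n (B ω)} {y : Matrix m' n (B ω)} {α β : ℝ}
    (hα : osyNorm ω x < α) (hβ : osyNorm ω y < β) :
    osyNorm ω (Matrix.of (Sum.elim x y) : Matrix (m ⊕ m') n (B ω))
      ≤ Real.sqrt (α ^ 2 + β ^ 2) := by
  have hα0 : 0 < α := (osyNorm_nonneg x).trans_lt hα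
  have hβ0 : 0 < β := (osyNorm_nonneg y).trans_lt hβ
  set T := Real.sqrt (α ^ 2 + β ^ 2) with hT
  have hT0 : 0 < T := Real.sqrt_pos.2 (by positivity)
  have hT2 : T ^ 2 = α ^ 2 + β ^ 2 := Real.sq_sqrt (by positivity)
  have h := ((adm_of_lt hα).scale hα0 hT0).stack ((adm_of_lt hβ).scale hβ0 hT0)
  have e : α ^ 2 / T + β ^ 2 / T = T := by
    rw [← add_div, ← hT2]; field_simp
  rw [e] at h
  exact osyNorm_le hT0.le h

lemma osyNorm_reindex_le (x : Matrix m n (B ω)) (e : m' ≃ m) :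
    osyNorm ω (x.submatrix e id) ≤ osyNorm ω x := by
  refine le_of_forall_pos_le_add fun ε hε => ?_
  obtain ⟨s, hs0, hs, hx⟩ := exists_adm_lt (lt_add_of_pos_right (osyNorm ω x) hε)
  exact (osyNorm_le hs0 (hx.reindex e)).trans hs.le

end OrderNorm

section MatrixNorms

open Matrix UniformSpace

/-- A family of norms on the matrices over a vector space, as it enters the definition of an
(abstract) operator space. -/
abbrev MatrixNorms (E : Type*) := ∀ m n : ℕ, Matrix (Fin m) (Fin n) E → ℝ

/-- The matrix norms of a `C⋆`-algebra. -/
noncomputable def cstarNorms (D : Type*) [CStarAlgebra D] : MatrixNorms D := fun m n M =>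
  letI := CStarAlgebra.spectralOrder D
  letI := CStarAlgebra.spectralOrderedRing D
  ‖(CStarMatrix.ofMatrix M : CStarMatrix (Fin m) (Fin n) D)‖

/-- The operator system matrix norms of `B_ω`. -/
noncomputable def osyNorms {A : Type u} [CStarAlgebra A] (ω : State (AZ A)) : MatrixNorms (B ω) :=
  fun _ _ x => osyNorm ω x

/-- The Haagerup matrix norms on the algebraic tensor product:
`‖x‖ = inf {‖u‖ ‖v‖ | x = u ⊙ v}`, where `(u ⊙ v)_ij = ∑ₖ u_ik ⊗ v_kj`. -/
noncomputable def haagerupNorms {E F : Type*} [AddCommGroup E] [Module ℂ E] [AddCommGroup F]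
    [Module ℂ F] (νE : MatrixNorms E) (νF : MatrixNorms F) : MatrixNorms (E ⊗[ℂ] F) :=
  fun m n x => sInf {r : ℝ | ∃ (p : ℕ) (u : Matrix (Fin m) (Fin p) E)
    (v : Matrix (Fin p) (Fin n) F),
    x = Matrix.of (fun i j => ∑ k, u i k ⊗ₜ[ℂ] v k j) ∧ r = νE m p u * νF p n v}

/-- The extension by continuity of matrix norms to the completion: the closed ball of radius `r` is
the closure of the ball of radius `r`. -/
noncomputable def completionNorms {E : Type*} [UniformSpace E] (ν : MatrixNorms E) :
    MatrixNorms (Completion E) :=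
  fun m n x => sInf {r : ℝ | 0 ≤ r ∧
    x ∈ closure ((fun y : Matrix (Fin m) (Fin n) E => y.map ((↑) : E → Completion E)) ''
      {y | ν m n y ≤ r})}

/-- All matrix amplifications of the linear map `φ` are contractions. -/
def IsCompletelyContractive {E F : Type*} [AddCommGroup E] [Module ℂ E] [AddCommGroup F]
    [Module ℂ F] (νE : MatrixNorms E) (νF : MatrixNorms F) (φ : E →ₗ[ℂ] F) : Prop :=
  ∀ (n : ℕ) (x : Matrix (Fin n) (Fin n) E), νF n n (x.map φ) ≤ νE n n x

/-- All matrix amplifications `([x_ij], [y_ij]) ↦ [∑ₖ φ (x_ik, y_kj)]` of the bilinear map `φ` are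
contractions. -/
def IsCompletelyContractiveBilinear {E F G : Type*} [AddCommGroup E] [Module ℂ E]
    [AddCommGroup F] [Module ℂ F] [AddCommGroup G] [Module ℂ G] (νE : MatrixNorms E)
    (νF : MatrixNorms F) (νG : MatrixNorms G) (φ : E →ₗ[ℂ] F →ₗ[ℂ] G) : Prop :=
  ∀ (n : ℕ) (x : Matrix (Fin n) (Fin n) E) (y : Matrix (Fin n) (Fin n) F),
    νG n n (Matrix.of fun i j => ∑ k, φ (x i k) (y k j)) ≤ νE n n x * νF n n y

end MatrixNorms

section HaagerupSeminorm

open Matrix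

variable {E F : Type*} [AddCommGroup E] [Module ℂ E] [AddCommGroup F] [Module ℂ F]

/-- What is needed to see that the Haagerup norm is a seminorm. -/
structure HaagerupData (νE : MatrixNorms E) (νF : MatrixNorms F) : Prop where
  nonnegE : ∀ p u, 0 ≤ νE 1 p u
  nonnegF : ∀ p v, 0 ≤ νF p 1 v
  smulE : ∀ p (c : ℂ) u, νE 1 p (c • u) ≤ ‖c‖ * νE 1 p u
  smulF : ∀ p (c : ℂ) v, νF p 1 (c • v) ≤ ‖c‖ * νF p 1 v
  rowE : ∀ p q u u' (α β : ℝ), νE 1 p u < α → νE 1 q u' < β →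
    νE 1 (p + q) (Matrix.of fun i => Fin.append (u i) (u' i)) ≤ Real.sqrt (α ^ 2 + β ^ 2)
  colF : ∀ p q v v' (α β : ℝ), νF p 1 v < α → νF q 1 v' < β →
    νF (p + q) 1 (Matrix.of fun k j => Fin.append (fun k => v k j) (fun k => v' k j) k)
      ≤ Real.sqrt (α ^ 2 + β ^ 2)

variable {νE : MatrixNorms E} {νF : MatrixNorms F}

/-- The Haagerup norm of a single tensor. -/
noncomputable def haagerupNorm (νE : MatrixNorms E) (νF : MatrixNorms F) (x : E ⊗[ℂ] F) : ℝ :=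
  haagerupNorms νE νF 1 1 (Matrix.of fun _ _ => x)

lemma haagerupNorm_nonneg (h : HaagerupData νE νF) (x : E ⊗[ℂ] F) :
    0 ≤ haagerupNorm νE νF x := by
  refine Real.sInf_nonneg ?_
  rintro _ ⟨p, u, v, _, rfl⟩
  exact mul_nonneg (h.nonnegE _ _) (h.nonnegF _ _)

lemma haagerupNorm_le (h : HaagerupData νE νF) {p : ℕ} (u : Matrix (Fin 1) (Fin p) E)
    (v : Matrix (Fin p) (Fin 1) F) :
    haagerupNorm νE νF (∑ k, u 0 k ⊗ₜ[ℂ] v k 0) ≤ νE 1 p u * νF p 1 v := by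
  refine csInf_le ⟨0, ?_⟩ ⟨p, u, v, ?_, rfl⟩
  · rintro _ ⟨p, u, v, _, rfl⟩
    exact mul_nonneg (h.nonnegE _ _) (h.nonnegF _ _)
  · ext i j
    fin_cases i
    fin_cases j
    rfl

lemma exists_haagerup_rep (x : E ⊗[ℂ] F) : ∃ (p : ℕ) (u : Matrix (Fin 1) (Fin p) E)
    (v : Matrix (Fin p) (Fin 1) F), x = ∑ k, u 0 k ⊗ₜ[ℂ] v k 0 := by
  induction x using TensorProduct.induction_on with
  | zero => exact ⟨0, 0, 0, by simp⟩
  | tmul a b => exact ⟨1, fun _ _ => a, fun _ _ => b, by simp⟩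
  | add x y hx hy =>
    obtain ⟨p, u, v, rfl⟩ := hx
    obtain ⟨q, u', v', rfl⟩ := hy
    exact ⟨p + q, fun i => Fin.append (u i) (u' i),
      fun k j => Fin.append (fun k => v k j) (fun k => v' k j) k, by simp [Fin.sum_univ_add]⟩

lemma exists_haagerup_lt {x : E ⊗[ℂ] F} {r : ℝ}
    (hx : haagerupNorm νE νF x < r) : ∃ (p : ℕ) (u : Matrix (Fin 1) (Fin p) E)
    (v : Matrix (Fin p) (Fin 1) F), x = ∑ k, u 0 k ⊗ₜ[ℂ] v k 0 ∧ νE 1 p u * νF p 1 v < r := by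
  obtain ⟨p, u, v, huv⟩ := exists_haagerup_rep x
  obtain ⟨_, ⟨p', u', v', h', rfl⟩, hr⟩ := exists_lt_of_csInf_lt
    (s := {r : ℝ | ∃ (p : ℕ) (u : Matrix (Fin 1) (Fin p) E) (v : Matrix (Fin p) (Fin 1) F),
      (Matrix.of fun _ _ => x : Matrix (Fin 1) (Fin 1) (E ⊗[ℂ] F))
        = Matrix.of (fun i j => ∑ k, u i k ⊗ₜ[ℂ] v k j) ∧ r = νE 1 p u * νF p 1 v})
    ⟨_, p, u, v, by
      ext i j
      fin_cases i
      fin_cases j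
      exact huv, rfl⟩ hx
  exact ⟨p', u', v', congrFun (congrFun h' 0) 0, hr⟩

/-- Rescaled factorizations. -/
lemma exists_haagerup_balanced (h : HaagerupData νE νF) {x : E ⊗[ℂ] F} {r : ℝ}
    (hx : haagerupNorm νE νF x < r) : ∃ (p : ℕ) (u : Matrix (Fin 1) (Fin p) E)
    (v : Matrix (Fin p) (Fin 1) F), x = ∑ k, u 0 k ⊗ₜ[ℂ] v k 0 ∧ νE 1 p u < Real.sqrt r ∧
      νF p 1 v < Real.sqrt r := by
  obtain ⟨p, u, v, rfl, hr⟩ := exists_haagerup_lt hx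
  have ha := h.nonnegE p u
  have hb := h.nonnegF p v
  set a := νE 1 p u
  set b := νF p 1 v
  have hr0 : 0 < r := (mul_nonneg ha hb).trans_lt hr
  obtain ⟨δ, hδ, hδr⟩ : ∃ δ > 0, (a + δ) * (b + δ) < r := by
    have hc : Filter.Tendsto (fun δ : ℝ => (a + δ) * (b + δ)) (nhdsWithin 0 (Set.Ioi 0))
        (nhds ((a + 0) * (b + 0))) :=
      (Continuous.tendsto (by fun_prop) 0).mono_left nhdsWithin_le_nhds
    have := (hc.eventually_lt_const (by simpa using hr)).and self_mem_nhdsWithin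
    obtain ⟨δ, h1, h2⟩ := this.exists
    exact ⟨δ, h2, h1⟩
  set t : ℝ := Real.sqrt ((b + δ) / (a + δ)) with ht
  have ha' : 0 < a + δ := by positivity
  have hb' : 0 < b + δ := by positivity
  have ht0 : 0 < t := Real.sqrt_pos.2 (by positivity)
  have hlt : Real.sqrt ((a + δ) * (b + δ)) < Real.sqrt r := Real.sqrt_lt_sqrt (by positivity) hδr
  refine ⟨p, (t : ℂ) • u, ((t⁻¹ : ℝ) : ℂ) • v, ?_, ?_, ?_⟩
  · refine Finset.sum_congr rfl fun k _ => ?_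
    rw [Matrix.smul_apply, Matrix.smul_apply, TensorProduct.smul_tmul_smul, ← Complex.ofReal_mul,
      mul_inv_cancel₀ ht0.ne']
    simp
  · calc νE 1 p ((t : ℂ) • u) ≤ ‖(t : ℂ)‖ * a := h.smulE _ _ _
      _ = t * a := by rw [Complex.norm_real, Real.norm_of_nonneg ht0.le]
      _ ≤ t * (a + δ) := by gcongr; linarith
      _ = Real.sqrt ((a + δ) * (b + δ)) := by
        have h1 : Real.sqrt ((b + δ) / (a + δ)) * Real.sqrt ((a + δ) * (a + δ))
            = Real.sqrt ((a + δ) * (b + δ)) := by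
          rw [← Real.sqrt_mul (by positivity)]
          congr 1
          field_simp
        rwa [Real.sqrt_mul_self ha'.le] at h1
      _ < _ := hlt
  · calc νF p 1 (((t⁻¹ : ℝ) : ℂ) • v) ≤ ‖((t⁻¹ : ℝ) : ℂ)‖ * b := h.smulF _ _ _
      _ = t⁻¹ * b := by rw [Complex.norm_real, Real.norm_of_nonneg (inv_pos.2 ht0).le]
      _ ≤ t⁻¹ * (b + δ) := by gcongr; linarith
      _ = Real.sqrt ((a + δ) * (b + δ)) := by
        have h1 : t⁻¹ * Real.sqrt ((b + δ) * (b + δ)) = Real.sqrt ((a + δ) * (b + δ)) := by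
          rw [ht, ← Real.sqrt_inv, inv_div, ← Real.sqrt_mul (by positivity)]
          congr 1
          field_simp
        rwa [Real.sqrt_mul_self hb'.le] at h1
      _ < _ := hlt

/-- The Haagerup norm as a seminorm. -/
noncomputable def haagerupSeminorm (h : HaagerupData νE νF) : Seminorm ℂ (E ⊗[ℂ] F) :=
  Seminorm.ofSMulLE (haagerupNorm νE νF)
    (by
      refine le_antisymm ?_ (haagerupNorm_nonneg h 0)
      have h1 := haagerupNorm_le h (0 : Matrix (Fin 1) (Fin 0) E) (0 : Matrix (Fin 0) (Fin 1) F)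
      have h2 := h.smulE 0 0 (0 : Matrix (Fin 1) (Fin 0) E)
      have h3 := h.nonnegE 0 (0 : Matrix (Fin 1) (Fin 0) E)
      simp only [smul_zero, norm_zero, zero_mul] at h2
      rw [le_antisymm h2 h3] at h1
      simpa using h1)
    (fun x y => by
      refine le_of_forall_pos_le_add fun ε hε => ?_
      have hx0 := haagerupNorm_nonneg h x
      have hy0 := haagerupNorm_nonneg h y
      obtain ⟨p, u, v, hx, hu, hv⟩ := exists_haagerup_balanced h
        (lt_add_of_pos_right (haagerupNorm νE νF x) (half_pos hε))
      obtain ⟨q, u', v', hy, hu', hv'⟩ := exists_haagerup_balanced h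
        (lt_add_of_pos_right (haagerupNorm νE νF y) (half_pos hε))
      have key := haagerupNorm_le h
        (Matrix.of fun i => Fin.append (u i) (u' i)) (Matrix.of fun k j => Fin.append (fun k => v k j) (fun k => v' k j) k)
      have e : (∑ k, (Matrix.of fun i => Fin.append (u i) (u' i)) 0 k
          ⊗ₜ[ℂ] (Matrix.of fun k j => Fin.append (fun k => v k j) (fun k => v' k j) k) k 0) = x + y := by
        rw [hx, hy, Fin.sum_univ_add]
        simp
      rw [e] at key
      have b1 := h.rowE p q u u' _ _ hu hu'
      have b2 := h.colF p q v v' _ _ hv hv'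
      refine key.trans ((mul_le_mul b1 b2 (h.nonnegF _ _) (Real.sqrt_nonneg _)).trans ?_)
      rw [Real.mul_self_sqrt (by positivity), Real.sq_sqrt (by positivity),
        Real.sq_sqrt (by positivity)]
      linarith)
    (fun c x => by
      refine le_of_forall_pos_le_add fun ε hε => ?_
      have hx0 := haagerupNorm_nonneg h x
      have hc1 : 0 < ‖c‖ + 1 := by positivity
      obtain ⟨p, u, v, hx, hr⟩ := exists_haagerup_lt
        (lt_add_of_pos_right (haagerupNorm νE νF x) (div_pos hε hc1))
      have key := haagerupNorm_le h (c • u) v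
      have e : (∑ k, (c • u) 0 k ⊗ₜ[ℂ] v k 0) = c • x := by
        rw [hx, Finset.smul_sum]
        rfl
      rw [e] at key
      have hs := h.smulE p c u
      have hv := h.nonnegF p v
      calc haagerupNorm νE νF (c • x) ≤ νE 1 p (c • u) * νF p 1 v := key
        _ ≤ ‖c‖ * νE 1 p u * νF p 1 v := by gcongr
        _ = ‖c‖ * (νE 1 p u * νF p 1 v) := by ring
        _ ≤ ‖c‖ * (haagerupNorm νE νF x + ε / (‖c‖ + 1)) := by gcongr
        _ = ‖c‖ * haagerupNorm νE νF x + ‖c‖ / (‖c‖ + 1) * ε := by ring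
        _ ≤ ‖c‖ * haagerupNorm νE νF x + 1 * ε := by
          gcongr
          rw [div_le_one hc1]
          linarith
        _ = ‖c‖ * haagerupNorm νE νF x + ε := by ring)

end HaagerupSeminorm

section HaagerupSpace

open Matrix UniformSpace

section Row

attribute [local instance] CStarAlgebra.spectralOrder CStarAlgebra.spectralOrderedRing

variable {D : Type u} [CStarAlgebra D]

lemma cstar_row_le {p q : ℕ} (x : Matrix (Fin 1) (Fin p) D) (y : Matrix (Fin 1) (Fin q) D)
    {α β : ℝ} (hα : cstarNorms D 1 p x < α) (hβ : cstarNorms D 1 q y < β) :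
    cstarNorms D 1 (p + q) (Matrix.of fun i => Fin.append (x i) (y i))
      ≤ Real.sqrt (α ^ 2 + β ^ 2) := by
  have hα' : ‖CStarMatrix.toCLM (CStarMatrix.ofMatrix x)‖ < α := hα
  have hβ' : ‖CStarMatrix.toCLM (CStarMatrix.ofMatrix y)‖ < β := hβ
  change ‖CStarMatrix.toCLM (CStarMatrix.ofMatrix
    (Matrix.of fun i => Fin.append (x i) (y i)))‖ ≤ _
  refine ContinuousLinearMap.opNorm_le_bound _ (Real.sqrt_nonneg _) fun v => ?_
  have hx := (CStarMatrix.toCLM (CStarMatrix.ofMatrix x)).le_of_opNorm_le hα'.le v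
  have hy := (CStarMatrix.toCLM (CStarMatrix.ofMatrix y)).le_of_opNorm_le hβ'.le v
  have hv := norm_nonneg v
  have key : ‖CStarMatrix.toCLM (CStarMatrix.ofMatrix
      (Matrix.of fun i => Fin.append (x i) (y i))) v‖ ^ 2
      ≤ ‖CStarMatrix.toCLM (CStarMatrix.ofMatrix x) v‖ ^ 2
        + ‖CStarMatrix.toCLM (CStarMatrix.ofMatrix y) v‖ ^ 2 := by
    rw [WithCStarModule.pi_norm_sq, WithCStarModule.pi_norm_sq, WithCStarModule.pi_norm_sq,
      Fin.sum_univ_add]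
    refine (norm_add_le _ _).trans (le_of_eq ?_)
    simp only [CStarMatrix.toCLM_apply_eq_sum, WithCStarModule.equiv_symm_pi_apply,
      CStarMatrix.ofMatrix_apply, Matrix.of_apply, Fin.append_left, Fin.append_right]
  refine (pow_le_pow_iff_left₀ (norm_nonneg _) (by positivity) two_ne_zero).1 ?_
  rw [mul_pow, Real.sq_sqrt (by positivity), add_mul, ← mul_pow, ← mul_pow]
  exact key.trans (add_le_add (pow_le_pow_left₀ (norm_nonneg _) hx 2)
    (pow_le_pow_left₀ (norm_nonneg _) hy 2))

end Row

variable {A : Type u} [CStarAlgebra A] (ω : State (AZ A))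

lemma haagerupData : HaagerupData (cstarNorms A) (osyNorms ω) where
  nonnegE p u := by
    let := CStarAlgebra.spectralOrder A
    let := CStarAlgebra.spectralOrderedRing A
    exact norm_nonneg (CStarMatrix.ofMatrix u)
  nonnegF _ _ := osyNorm_nonneg _
  smulE p c u := by
    let := CStarAlgebra.spectralOrder A
    let := CStarAlgebra.spectralOrderedRing A
    exact (norm_smul c (CStarMatrix.ofMatrix u)).le
  smulF _ c v := osyNorm_smul_le c v
  rowE _ _ x y _ _ hα hβ := cstar_row_le x y hα hβ
  colF p q x y _ _ hα hβ := by
    refine le_trans (le_of_eq_of_le ?_ (osyNorm_reindex_le _ finSumFinEquiv.symm))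
      (osyNorm_stack_le hα hβ)
    unfold osyNorms
    congr 1
    ext k j
    refine Fin.addCases (fun k => ?_) (fun k => ?_) k <;> simp <;> rfl

/-- The norm of `B_ω`, the first of the operator system matrix norms, as a seminorm. -/
noncomputable def osySeminorm : Seminorm ℂ (B ω) :=
  Seminorm.ofSMulLE (fun b => osyNorms ω 1 1 (Matrix.of fun _ _ => b))
    (le_antisymm (osyNorm_le le_rfl (Adm.zero le_rfl le_rfl)) (osyNorm_nonneg _))
    (fun x y => osyNorm_add_le (Matrix.of fun _ _ : Fin 1 => x) (Matrix.of fun _ _ : Fin 1 => y))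
    (fun c x => osyNorm_smul_le c (Matrix.of fun _ _ : Fin 1 => x))

noncomputable instance : SeminormedAddCommGroup (B ω) :=
  { (osySeminorm ω).toAddGroupSeminorm.toSeminormedAddCommGroup with
    toAddCommGroup := inferInstance }

noncomputable instance : NormedSpace ℂ (B ω) where
  norm_smul_le c x := ((osySeminorm ω).smul' c x).le

/-- The algebraic tensor product `A ⊗ B_ω`, to be equipped with the Haagerup norm. -/
def AlgHaagerup : Type u := A ⊗[ℂ] B ω

noncomputable instance : AddCommGroup (AlgHaagerup ω) := inferInstanceAs (AddCommGroup (A ⊗[ℂ] B ω))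
noncomputable instance : Module ℂ (AlgHaagerup ω) := inferInstanceAs (Module ℂ (A ⊗[ℂ] B ω))

noncomputable instance : SeminormedAddCommGroup (AlgHaagerup ω) :=
  { (show Seminorm ℂ (AlgHaagerup ω) from
      haagerupSeminorm (haagerupData ω)).toAddGroupSeminorm.toSeminormedAddCommGroup with
    toAddCommGroup := inferInstance }

noncomputable instance : NormedSpace ℂ (AlgHaagerup ω) where
  norm_smul_le c x := ((haagerupSeminorm (haagerupData ω)).smul' c x).le

/-- The elementary tensor `a ⊗ b`. -/
noncomputable def AlgHaagerup.tmul (a : A) (b : B ω) : AlgHaagerup ω := a ⊗ₜ[ℂ] b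

/-- The Haagerup matrix norms of `A ⊗ B_ω`. -/
noncomputable def algHaagerupNorms : MatrixNorms (AlgHaagerup ω) :=
  (haagerupNorms (cstarNorms A) (osyNorms ω) : MatrixNorms (A ⊗[ℂ] B ω))

/-- The Haagerup tensor product `A ⊗_h B_ω`, with the matrix norms
`completionNorms (algHaagerupNorms ω)`. -/
abbrev Haagerup : Type u := Completion (AlgHaagerup ω)

end HaagerupSpace

end OPS

namespace OPS

open Matrix UniformSpace

/-! ### Estimates for the two families of matrix norms -/

section MatrixNormEstimates

attribute [local instance] CStarAlgebra.spectralOrder CStarAlgebra.spectralOrderedRing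

variable {D : Type u} [CStarAlgebra D]

/-! Everything rests on the identity ξ_R(a ⊗ r) = α₁⁻¹(a) S(r) (`xiR_eq`): a product of values of
two unital ⋆-homomorphisms into A_R with commuting ranges, one at the site 1 and the other on the
sites n ≥ 2.

Well-definedness. Invariance of ω gives ω(x ξ_R(a ⊗ r)) = ω(S⁻¹(x) α₀⁻¹(a) r), and S⁻¹(x) α₀⁻¹(a)
still lies in A_L when x does. Hence r ∈ K_ω forces ξ_R(a ⊗ r) ∈ K_ω (`xiR_mem_entKernel`).

Complete contractivity (`Adm.ampTransfer`). Take a lift of [[a e, y], [y⋆, b e]] that is positive up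
to δ, apply S entrywise and conjugate by U ⊕ 1, where U = α₁⁻¹(x). The off-diagonal corner now
represents [∑ₖ E(x_ik, y_kj)]. In the upper left corner U⋆ commutes with the shifted entries, so the
class is a ⌊U U⋆⌋ although K_ω is not assumed to be an ideal. For t ≥ ‖x‖, adding a (t² − U U⋆) ≥ 0
turns this corner into a t² e. Rebalancing the two diagonal entries gives the bound t s whenever s >
‖y‖ and t > ‖x‖.

Haagerup norm and completion. The linearization of E sends u ⊙ v to the amplification of E at (u,
v), so the rectangular form of the estimate bounds it through every factorization
(`osyNorms_map_lift_transfer_le`). A continuous extension carries closures of balls into closures of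
balls. What remains is that every matrix over A ⊗_h B_ω lies in the closure of some ball; this holds
because matrices with bounded entries have factorizations with uniformly bounded factors
(`hasFactorization_of_entries`). -/

lemma cstarNorms_nonneg {m p : ℕ} (x : Matrix (Fin m) (Fin p) D) : 0 ≤ cstarNorms D m p x :=
  norm_nonneg (CStarMatrix.ofMatrix x)

/-- The conjugate transpose acts as the adjoint for the D-valued inner product, so Cauchy–Schwarz in
the Hilbert module bounds it by ‖x‖. -/
lemma norm_cstarMatrix_conjTranspose_le {m p : ℕ} (x : CStarMatrix (Fin m) (Fin p) D) :
    ‖x.conjTranspose‖ ≤ ‖x‖ := by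
  refine CStarMatrix.norm_le_of_forall_inner_le (C := ‖x‖₊) fun v w => ?_
  refine (congrArg norm CStarMatrix.inner_toCLM_conjTranspose_right).trans_le ?_
  refine (CStarModule.norm_inner_le (WithCStarModule D (Fin p → D))).trans ?_
  calc _ ≤ (‖x‖ * ‖w‖) * ‖v‖ := by
        gcongr
        exact (CStarMatrix.toCLM x).le_opNorm w
    _ = _ := by rw [coe_nnnorm]; ring

/-- Matrices act on row vectors from the right, so the product is a composition in reversed order
and the operator norm is submultiplicative. -/
lemma norm_cstarMatrix_mul_le {m p q : ℕ} (x : CStarMatrix (Fin m) (Fin p) D)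
    (y : CStarMatrix (Fin p) (Fin q) D) : ‖x * y‖ ≤ ‖x‖ * ‖y‖ := by
  have h : CStarMatrix.toCLM (x * y) = (CStarMatrix.toCLM y).comp (CStarMatrix.toCLM x) := by
    refine ContinuousLinearMap.ext fun v => ?_
    exact congrArg (WithCStarModule.equiv D (Fin q → D)).symm
      (Matrix.vecMul_vecMul (WithCStarModule.equiv D _ v) (CStarMatrix.ofMatrix.symm x)
        (CStarMatrix.ofMatrix.symm y)).symm
  rw [CStarMatrix.norm_def, h, mul_comm]
  exact ContinuousLinearMap.opNorm_comp_le _ _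

/-- `x x⋆ ≤ ‖x‖²` for rectangular matrices over a `C⋆`-algebra. -/
lemma matPos_sq_smul_one_sub {m p : ℕ} {x : Matrix (Fin m) (Fin p) D} {t : ℝ}
    (h : cstarNorms D m p x ≤ t) :
    MatPos (((t ^ 2 : ℝ) : ℂ) • (1 : Matrix (Fin m) (Fin m) D) - x * xᴴ) := by
  let X : CStarMatrix (Fin m) (Fin p) D := CStarMatrix.ofMatrix x
  have hX : ‖X‖ ≤ t := h
  have hs : IsSelfAdjoint (X * X.conjTranspose) := by
    change (x * xᴴ)ᴴ = x * xᴴ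
    rw [conjTranspose_mul, conjTranspose_conjTranspose]
  have hn : ‖X * X.conjTranspose‖ ≤ t ^ 2 := by
    refine (norm_cstarMatrix_mul_le _ _).trans ?_
    rw [sq]
    exact mul_le_mul hX ((norm_cstarMatrix_conjTranspose_le X).trans hX) (norm_nonneg _)
      ((norm_nonneg _).trans hX)
  -- A self-adjoint element is at most its norm; the remaining slack t² − ‖x x⋆‖ is a nonnegative
  -- multiple of the unit.
  have h1 := sub_nonneg.2 hs.le_algebraMap_norm_self
  rw [IsScalarTower.algebraMap_apply ℝ ℂ, Algebra.algebraMap_eq_smul_one] at h1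
  have h2 := matPos_smul_one (D := D) (ι := Fin m) (sub_nonneg.2 hn)
  have h3 : MatPos (((‖X * X.conjTranspose‖ : ℝ) : ℂ) • (1 : Matrix (Fin m) (Fin m) D) - x * xᴴ) :=
    (matPos_iff _).2 h1
  convert h2.add h3 using 1
  rw [Complex.ofReal_sub, sub_smul]
  abel

/-- The Hilbert module norm squared of a concatenated vector is at most the sum of the squares. The
cruder bound by the sum suffices here: factorizations only have to stay bounded. -/
lemma cstarNorms_append_le {m p q : ℕ} (x : Matrix (Fin m) (Fin p) D)
    (y : Matrix (Fin m) (Fin q) D) :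
    cstarNorms D m (p + q) (Matrix.of fun i => Fin.append (x i) (y i))
      ≤ cstarNorms D m p x + cstarNorms D m q y := by
  change ‖CStarMatrix.toCLM (CStarMatrix.ofMatrix
    (Matrix.of fun i => Fin.append (x i) (y i)))‖ ≤ ‖CStarMatrix.toCLM (CStarMatrix.ofMatrix x)‖
      + ‖CStarMatrix.toCLM (CStarMatrix.ofMatrix y)‖
  refine ContinuousLinearMap.opNorm_le_bound _ (by positivity) fun v => ?_
  have hx := (CStarMatrix.toCLM (CStarMatrix.ofMatrix x)).le_opNorm v
  have hy := (CStarMatrix.toCLM (CStarMatrix.ofMatrix y)).le_opNorm v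
  have key : ‖CStarMatrix.toCLM (CStarMatrix.ofMatrix
      (Matrix.of fun i => Fin.append (x i) (y i))) v‖ ^ 2
      ≤ ‖CStarMatrix.toCLM (CStarMatrix.ofMatrix x) v‖ ^ 2
        + ‖CStarMatrix.toCLM (CStarMatrix.ofMatrix y) v‖ ^ 2 := by
    rw [WithCStarModule.pi_norm_sq, WithCStarModule.pi_norm_sq, WithCStarModule.pi_norm_sq,
      Fin.sum_univ_add]
    refine (norm_add_le _ _).trans (le_of_eq ?_)
    simp only [CStarMatrix.toCLM_apply_eq_sum, WithCStarModule.equiv_symm_pi_apply,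
      CStarMatrix.ofMatrix_apply, Matrix.of_apply, Fin.append_left, Fin.append_right]
  rw [add_mul]
  refine le_trans ?_ (add_le_add hx hy)
  refine abs_le_of_sq_le_sq' (key.trans ?_) (by positivity) |>.2
  nlinarith [norm_nonneg (CStarMatrix.toCLM (CStarMatrix.ofMatrix x) v),
    norm_nonneg (CStarMatrix.toCLM (CStarMatrix.ofMatrix y) v)]

/-- Padding a row with zero rows does not increase the norm. -/
lemma cstarNorms_padRow_le {m p : ℕ} (i : Fin m) (x : Matrix (Fin 1) (Fin p) D) :
    cstarNorms D m p (Matrix.of fun i' k => if i' = i then x 0 k else 0) ≤ cstarNorms D 1 p x := by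
  change ‖CStarMatrix.toCLM (CStarMatrix.ofMatrix
    (Matrix.of fun i' k => if i' = i then x 0 k else 0))‖
      ≤ ‖CStarMatrix.toCLM (CStarMatrix.ofMatrix x)‖
  refine ContinuousLinearMap.opNorm_le_bound _ (ContinuousLinearMap.opNorm_nonneg _) fun v => ?_
  -- Only the i-th coordinate of v meets a nonzero row, so the padded matrix acts on v as x acts on
  -- the single coordinate v i.
  let w : WithCStarModule D (Fin 1 → D) := (WithCStarModule.equiv _ _).symm fun _ => v i
  have hw : ‖w‖ ≤ ‖v‖ := by
    refine (WithCStarModule.pi_norm_le_sum_norm w).trans ?_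
    simpa [w] using WithCStarModule.norm_apply_le_norm v i
  have e : CStarMatrix.toCLM (CStarMatrix.ofMatrix
      (Matrix.of fun i' k => if i' = i then x 0 k else 0)) v
        = CStarMatrix.toCLM (CStarMatrix.ofMatrix x) w := by
    rw [CStarMatrix.toCLM_apply_eq_sum, CStarMatrix.toCLM_apply_eq_sum]
    congr 1
    funext k
    simp [w]
  rw [e]
  exact ((CStarMatrix.toCLM (CStarMatrix.ofMatrix x)).le_opNorm w).trans (by gcongr)

variable {A : Type u} [CStarAlgebra A] {ω : State (AZ A)}

lemma matPos_diagonal {ι : Type*} [Fintype ι] [DecidableEq ι] {d : ι → ℝ} (hd : ∀ i, 0 ≤ d i) :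
    MatPos (Matrix.diagonal fun i => (d i : ℂ) • (1 : D)) := by
  refine ⟨Matrix.diagonal fun i => ((Real.sqrt (d i) : ℝ) : ℂ) • 1, ?_⟩
  rw [Matrix.diagonal_conjTranspose, Matrix.diagonal_mul_diagonal]
  congr 1
  funext i
  simp [smul_smul, Real.mul_self_sqrt (hd i)]

lemma diagonal_mem_cone {ι : Type*} [Fintype ι] [DecidableEq ι] {d : ι → ℝ} (hd : ∀ i, 0 ≤ d i) :
    (Matrix.diagonal fun i => (d i : ℂ) • unitB ω) ∈ cone ω ι := fun ε hε => by
  refine ⟨Matrix.diagonal fun i => (d i : ℂ) • 1, ?_,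
    (matPos_smul_one hε.le).add (matPos_diagonal hd)⟩
  rw [Matrix.diagonal_map (map_zero _)]
  congr 1

/-- Padding a column with zero columns does not increase the norm. -/
lemma Adm.padCol {m n : Type*} [Fintype m] [Fintype n] [DecidableEq m] [DecidableEq n] {a b : ℝ}
    (hb : 0 ≤ b) (j : n) {x : Matrix m (Fin 1) (B ω)} (hx : Adm ω a b x) :
    Adm ω a b (Matrix.of fun k j' => if j' = j then x k 0 else 0) := by
  have h1 := cone_conj hx (Matrix.of fun (i : m ⊕ Fin 1) (k : m ⊕ n) =>
    if Sum.map id (fun _ => j) i = k then (1 : ℂ) else 0)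
  -- The compression `h1` has the entry b e at the diagonal position j and zeros at the other column
  -- positions; these are filled in with b e, which is where b ≥ 0 enters.
  have h2 := diagonal_mem_cone (ω := ω) (d := Sum.elim (fun _ : m => 0)
    fun j' : n => if j' = j then 0 else b) (by
      rintro (i | j')
      · exact le_rfl
      · simp only [Sum.elim_inr]
        split_ifs
        exacts [le_rfl, hb])
  have := cone_add h1 h2
  unfold Adm
  convert this using 1
  ext (k | k) (l | l)
  · simp [Fintype.sum_sum_type, Matrix.diagonal_apply, apply_ite star, ite_smul]
  · simp [Fintype.sum_sum_type, Matrix.diagonal_apply, apply_ite star, ite_smul, eq_comm]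
  · simp [Fintype.sum_sum_type, Matrix.diagonal_apply, apply_ite star, ite_smul, eq_comm]
  · by_cases h1 : k = j <;> by_cases h2 : l = j <;> by_cases h3 : k = l <;>
      simp_all [Fintype.sum_sum_type, Matrix.diagonal_apply, apply_ite star, ite_smul, eq_comm]

lemma osyNorm_padCol_le {m n : Type*} [Fintype m] [Fintype n] [DecidableEq m] [DecidableEq n]
    (j : n) (x : Matrix m (Fin 1) (B ω)) :
    osyNorm ω (Matrix.of fun k j' => if j' = j then x k 0 else 0 : Matrix m n (B ω))
      ≤ osyNorm ω x := by
  refine le_of_forall_gt_imp_ge_of_dense fun r hr => ?_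
  obtain ⟨s, hs0, hs, hx⟩ := exists_adm_lt hr
  exact (osyNorm_le hs0 (hx.padCol hs0 j)).trans hs.le

/-- Stacking costs √(α² + β²), which is at most α + β for nonnegative α and β. -/
lemma osyNorms_append_le {p q n : ℕ} (x : Matrix (Fin p) (Fin n) (B ω))
    (y : Matrix (Fin q) (Fin n) (B ω)) :
    osyNorms ω (p + q) n
      (Matrix.of fun k j => Fin.append (fun k => x k j) (fun k => y k j) k)
      ≤ osyNorms ω p n x + osyNorms ω q n y := by
  refine le_of_forall_pos_le_add fun ε hε => ?_
  have hx0 : 0 ≤ osyNorms ω p n x := osyNorm_nonneg x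
  have hy0 : 0 ≤ osyNorms ω q n y := osyNorm_nonneg y
  refine le_trans (le_of_eq_of_le ?_ (osyNorm_reindex_le _ finSumFinEquiv.symm))
    ((osyNorm_stack_le (lt_add_of_pos_right (osyNorms ω p n x) (half_pos hε))
      (lt_add_of_pos_right (osyNorms ω q n y) (half_pos hε))).trans ?_)
  · unfold osyNorms
    congr 1
    ext k j
    refine Fin.addCases (fun k => ?_) (fun k => ?_) k <;> simp <;> rfl
  · rw [Real.sqrt_le_left (by positivity)]
    nlinarith [mul_nonneg (add_nonneg hx0 (half_pos hε).le) (add_nonneg hy0 (half_pos hε).le)]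

end MatrixNormEstimates

/-! ### The map E and its complete contractivity -/

section Transfer

variable {A : Type u} [CStarAlgebra A]

variable (A) in
/-- The embedding of `A` at the first site of the right half. -/
noncomputable def siteOne : A →⋆ₐ[ℂ] AR A :=
  (site A 1).codRestrict (region A (Set.Ici 1)) fun a =>
    site_mem_region A (Set.mem_Ici.2 le_rfl) a

variable (A) in
/-- The restriction of the shift to the right half. -/
noncomputable def shiftR : AR A →⋆ₐ[ℂ] AR A :=
  ((shift A : AZ A →⋆ₐ[ℂ] AZ A).comp (region A (Set.Ici 1)).subtype).codRestrict
    (region A (Set.Ici 1)) fun r => shift_mem_region A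
      (fun j hj => by simp only [Set.mem_Ici] at hj ⊢; omega) r.2

/-- S is multiplicative and moves the site 0 to the site 1. In this form both factors are values of
unital ⋆-homomorphisms into A_R, which therefore preserve positivity of matrices. -/
lemma xiR_eq (a : A) (r : AR A) : xiR A a r = siteOne A a * shiftR A r := by
  apply Subtype.ext
  change shift A (site A 0 a * (r : AZ A)) = site A 1 a * shift A (r : AZ A)
  rw [map_mul, shift_site, zero_add]

/-- S carries A_R to the sites n ≥ 2, which are disjoint from the site 1. -/
lemma siteOne_commute_shiftR (a : A) (r : AR A) : Commute (siteOne A a) (shiftR A r) := by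
  have h : Commute (site A 1 a) (shift A (r : AZ A)) :=
    region_commute A (s := {1}) (t := Set.Ici 2)
    (Set.disjoint_left.2 fun j h1 h2 => by
      simp only [Set.mem_singleton_iff, Set.mem_Ici] at h1 h2; omega)
    (site_mem_region A (Set.mem_singleton 1) a)
    (shift_mem_region A (s := Set.Ici 1) (t := Set.Ici 2)
      (fun j hj => by simp only [Set.mem_Ici] at hj ⊢; omega) r.2)
  exact Subtype.ext h.eq

/-- S⁻¹ moves the site j to j − 1, hence does not leave the left half; S itself would push the site
0 across the cut. -/
lemma shift_symm_mem_left {x : AZ A} (hx : x ∈ region A (Set.Iic 0)) :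
    (shift A).symm x ∈ region A (Set.Iic 0) := by
  have : region A (Set.Iic 0)
      ≤ (region A (Set.Iic 0)).comap ((shift A).symm : AZ A →⋆ₐ[ℂ] AZ A) := by
    refine region_le A ((isClosed_region A _).preimage (continuous_shiftFun A (-1)))
      fun j hj a => ?_
    change (shift A).symm (site A j a) ∈ region A (Set.Iic 0)
    have h : (shift A).symm (site A j a) = site A (j - 1) a := by
      rw [StarAlgEquiv.symm_apply_eq, shift_site, sub_add_cancel]
    rw [h]
    exact site_mem_region A (by simp only [Set.mem_Iic] at hj ⊢; omega) a
  exact this hx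

/-- Invariance transfers the shift to the test element: x is replaced by S⁻¹(x) α₀⁻¹(a), which is
again an admissible test element because it belongs to A_L. -/
lemma xiR_mem_entKernel {ω : State (AZ A)}
    (hω : ∀ x : AZ A, ω.toCLM (shift A x) = ω.toCLM x) (a : A) {r : AR A}
    (hr : r ∈ entKernel ω) : xiR A a r ∈ entKernel ω := fun x => by
  have h : ω.toCLM ((shift A).symm (x : AZ A) * site A 0 a * (r : AZ A)) = 0 := hr ⟨_,
    mul_mem (shift_symm_mem_left x.2) (site_mem_region A (Set.mem_Iic.2 le_rfl) a)⟩
  change ω.toCLM ((x : AZ A) * shift A (site A 0 a * (r : AZ A))) = 0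
  rwa [← hω, mul_assoc, map_mul (shift A), StarAlgEquiv.apply_symm_apply] at h

/-- The map `E (a, ⌊r⌋) = ⌊ξ_R (a ⊗ r)⌋`. -/
noncomputable def transfer (ω : State (AZ A))
    (hω : ∀ x : AZ A, ω.toCLM (shift A x) = ω.toCLM x) : A →ₗ[ℂ] B ω →ₗ[ℂ] B ω where
  toFun a := (entKernel ω).liftQ
    (cls ω ∘ₗ LinearMap.mulLeft ℂ (siteOne A a) ∘ₗ (shiftR A).toAlgHom.toLinearMap)
    fun r hr => by
      have h := xiR_mem_entKernel hω a hr
      rw [xiR_eq] at h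
      exact (Submodule.Quotient.mk_eq_zero _).2 h
  map_add' a b := by
    refine LinearMap.ext fun x => ?_
    obtain ⟨r, rfl⟩ := cls_surjective ω x
    change cls ω (siteOne A (a + b) * shiftR A r)
      = cls ω (siteOne A a * shiftR A r) + cls ω (siteOne A b * shiftR A r)
    rw [map_add, add_mul, map_add]
  map_smul' c a := by
    refine LinearMap.ext fun x => ?_
    obtain ⟨r, rfl⟩ := cls_surjective ω x
    change cls ω (siteOne A (c • a) * shiftR A r) = c • cls ω (siteOne A a * shiftR A r)
    rw [map_smul, smul_mul_assoc, map_smul]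

variable {ω : State (AZ A)} (hω : ∀ x : AZ A, ω.toCLM (shift A x) = ω.toCLM x)

lemma transfer_cls (a : A) (r : AR A) :
    transfer ω hω a (cls ω r) = cls ω (siteOne A a * shiftR A r) := rfl

lemma transfer_unitB (a : A) : transfer ω hω a (unitB ω) = cls ω (siteOne A a) := by
  unfold unitB
  rw [transfer_cls, map_one, mul_one]

/-- The right factor passes through S(r) and joins the left one. Thus two-sided multiplication of
shifted elements by elements at the site 1 depends only on the class of r, which is what conjugation
of a lift requires. -/
lemma cls_conj (a b : A) (r : AR A) :
    cls ω (siteOne A a * shiftR A r * siteOne A b) = transfer ω hω (a * b) (cls ω r) := by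
  rw [transfer_cls, mul_assoc, ← (siteOne_commute_shiftR b r).eq, ← mul_assoc, map_mul (siteOne A)]

lemma star_transfer (a : A) (x : B ω) :
    star (transfer ω hω a x) = transfer ω hω (star a) (star x) := by
  obtain ⟨r, rfl⟩ := cls_surjective ω x
  rw [transfer_cls, star_cls, star_cls, transfer_cls, star_mul, ← map_star, ← map_star,
    (siteOne_commute_shiftR _ _).eq]

lemma MatPos.map {D D' : Type u} [CStarAlgebra D] [CStarAlgebra D'] {ι : Type*} [Fintype ι]
    {M : Matrix ι ι D} (hM : MatPos M) (φ : D →⋆ₐ[ℂ] D') : MatPos (M.map φ) := by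
  obtain ⟨Y, rfl⟩ := hM
  refine ⟨Y.map φ, ?_⟩
  ext i j
  simp [Matrix.mul_apply, map_sum, map_mul, map_star]

lemma MatPos.smul {D : Type u} [CStarAlgebra D] {ι : Type*} [Fintype ι] {M : Matrix ι ι D}
    (hM : MatPos M) {c : ℝ} (hc : 0 ≤ c) : MatPos ((c : ℂ) • M) := by
  obtain ⟨Y, rfl⟩ := hM
  refine ⟨((Real.sqrt c : ℝ) : ℂ) • Y, ?_⟩
  rw [conjTranspose_smul, smul_mul_smul_comm]
  congr 1
  simp [← Complex.ofReal_mul, Real.mul_self_sqrt hc]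

lemma MatPos.fromBlocks_zero {D : Type u} [CStarAlgebra D] {ι κ : Type*} [Fintype ι] [Fintype κ]
    {M : Matrix ι ι D} {N : Matrix κ κ D} (hM : MatPos M) (hN : MatPos N) :
    MatPos (Matrix.fromBlocks M 0 0 N) := by
  obtain ⟨Y, rfl⟩ := hM
  obtain ⟨Z, rfl⟩ := hN
  refine ⟨Matrix.fromBlocks Y 0 0 Z, ?_⟩
  simp [Matrix.fromBlocks_conjTranspose, Matrix.fromBlocks_multiply]

/-- `[∑ₖ E (x_ik, y_kj)]`. -/
noncomputable def ampTransfer {m p n : Type*} [Fintype p] (x : Matrix m p A)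
    (y : Matrix p n (B ω)) : Matrix m n (B ω) :=
  Matrix.of fun i j => ∑ k, transfer ω hω (x i k) (y k j)

/-- Shift a positive lift and conjugate it by U ⊕ 1 with U = α₁⁻¹(x); then complete U U⋆ to t² in
the upper left corner. Only that corner is rescaled, so the two diagonal constants are kept separate
until the norm estimate balances them. -/
lemma Adm.ampTransfer {m p : ℕ} {n : Type*} [Fintype n] [DecidableEq n] {a b t : ℝ} (ha : 0 ≤ a)
    {x : Matrix (Fin m) (Fin p) A} (hx : cstarNorms A m p x ≤ t) {y : Matrix (Fin p) n (B ω)}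
    (hy : Adm ω a b y) : Adm ω (t ^ 2 * a) b (ampTransfer hω x y) := fun ε hε => by
  -- Conjugation turns the tolerance δ of the lift into δ U U⋆ in the upper block, which is
  -- completed to δ t². The choice δ t² + δ = ε makes the total tolerance exactly ε.
  set δ : ℝ := ε / (t ^ 2 + 1) with hδdef
  have hδ : 0 < δ := by positivity
  have hδ1 : δ * t ^ 2 + δ = ε := by rw [hδdef]; field_simp
  obtain ⟨X, hX, hpos⟩ := hy δ hδ
  obtain ⟨P, Q, R, T, rfl⟩ : ∃ P Q R T, X = Matrix.fromBlocks P Q R T :=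
    ⟨_, _, _, _, (Matrix.fromBlocks_toBlocks X).symm⟩
  rw [Matrix.fromBlocks_map, Matrix.fromBlocks_inj] at hX
  obtain ⟨hP, hQ, hR, hT⟩ := hX
  let U : Matrix (Fin m) (Fin p) (AR A) := x.map (siteOne A)
  have hU : MatPos (((t ^ 2 : ℝ) : ℂ) • (1 : Matrix (Fin m) (Fin m) (AR A)) - U * Uᴴ) := by
    convert (matPos_sq_smul_one_sub hx).map (siteOne A) using 1
    ext i j
    simp [U, Matrix.mul_apply, map_sum, map_star, Matrix.one_apply, apply_ite (siteOne A)]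
  -- The shifted and conjugated lift, corrected in its first block by the positive matrix a (t² − U
  -- U⋆) so that this block represents a t² e.
  refine ⟨Matrix.fromBlocks
    (U * P.map (shiftR A) * Uᴴ
      + (a : ℂ) • (((t ^ 2 : ℝ) : ℂ) • (1 : Matrix (Fin m) (Fin m) (AR A)) - U * Uᴴ))
    (U * Q.map (shiftR A)) (R.map (shiftR A) * Uᴴ) (T.map (shiftR A)), ?_, ?_⟩
  · rw [Matrix.fromBlocks_map]
    congr 1
    · ext i j
      -- Moving U⋆ to the left past the shifted entry leaves E(x_il x_jk⋆, ⌊P_lk⌋). As ⌊P_lk⌋ is a e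
      -- on the diagonal and 0 off it, only l = k survives.
      have e1 : cls ω ((U * P.map (shiftR A) * Uᴴ) i j)
          = (a : ℂ) • cls ω ((U * Uᴴ) i j) := by
        simp only [Matrix.mul_apply, Finset.sum_mul, map_sum, Finset.smul_sum]
        refine Finset.sum_congr rfl fun k _ => ?_
        have e2 : ∀ l, cls ω (U i l * P.map (shiftR A) l k * Uᴴ k j)
            = if l = k then (a : ℂ) • cls ω (U i k * Uᴴ k j) else 0 := fun l => by
          have e3 : cls ω (P l k) = if l = k then (a : ℂ) • unitB ω else 0 :=
            congrFun (congrFun hP l) k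
          have e4 : Uᴴ k j = siteOne A (star (x j k)) := by simp [U, map_star]
          rw [e4]
          change cls ω (siteOne A (x i l) * shiftR A (P l k) * siteOne A (star (x j k)))
            = if l = k then (a : ℂ) • cls ω (siteOne A (x i k) * siteOne A (star (x j k))) else 0
          rw [cls_conj hω, e3]
          split_ifs with h
          · rw [map_smul, transfer_unitB, map_mul (siteOne A), h]
          · rw [map_zero]
        rw [Finset.sum_congr rfl fun l _ => e2 l, Finset.sum_ite_eq' Finset.univ k,
          if_pos (Finset.mem_univ k)]
      simp only [Matrix.map_apply, Matrix.add_apply, Matrix.smul_apply, Matrix.sub_apply,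
        map_add, map_smul, map_sub, e1, smul_sub]
      by_cases h : i = j
      · subst h
        simp [unitB, smul_smul, mul_comm]
      · simp [h]
    · ext i j
      simp only [Matrix.map_apply, Matrix.mul_apply, map_sum, OPS.ampTransfer, Matrix.of_apply]
      refine Finset.sum_congr rfl fun k _ => ?_
      rw [← hQ]
      rfl
    · ext i j
      simp only [Matrix.map_apply, Matrix.mul_apply, map_sum, OPS.ampTransfer, Matrix.of_apply,
        Matrix.conjTranspose_apply, star_sum, star_transfer]
      refine Finset.sum_congr rfl fun k _ => ?_
      have e3 : cls ω (R i k) = star (y k i) := congrFun (congrFun hR i) k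
      -- Here U⋆ stands on the right, whereas E multiplies from the left; the two factors commute.
      rw [← e3, transfer_cls, (siteOne_commute_shiftR _ _).eq, map_star]
      rfl
    · ext i j
      have e3 : cls ω (T i j) = if i = j then (b : ℂ) • unitB ω else 0 :=
        congrFun (congrFun hT i) j
      -- The shift alone induces E(1, ·) on classes, and this fixes e.
      have e4 : cls ω (shiftR A (T i j)) = transfer ω hω 1 (cls ω (T i j)) := by
        rw [transfer_cls, map_one, one_mul]
      simp only [Matrix.map_apply, Matrix.diagonal_apply]
      rw [e4, e3]
      split_ifs
      · rw [map_smul, transfer_unitB, map_one, unitB]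
      · rw [map_zero]
  · have h1 := (hpos.map (shiftR A)).conj
      (Matrix.fromBlocks Uᴴ 0 0 (1 : Matrix n n (AR A)))
    have h2 := ((hU.smul ha).add ((hU.smul hδ.le).add (matPos_smul_one hδ.le))).fromBlocks_zero
      (matPos_smul_one (D := AR A) (ι := n) (mul_nonneg hδ.le (sq_nonneg t)))
    convert h1.add h2 using 1
    have e1 : (((δ : ℂ) • (1 : Matrix (Fin p ⊕ n) (Fin p ⊕ n) (AR A))
        + Matrix.fromBlocks P Q R T).map (shiftR A))
        = Matrix.fromBlocks ((δ : ℂ) • 1 + P.map (shiftR A)) (Q.map (shiftR A))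
          (R.map (shiftR A)) ((δ : ℂ) • 1 + T.map (shiftR A)) := by
      have e : shiftR A ((δ : ℂ) • 1) = (δ : ℂ) • 1 := by rw [map_smul, map_one]
      ext (i | i) (j | j) <;>
        simp [Matrix.one_apply, apply_ite (shiftR A), -Complex.coe_smul, e]
    have e2 : (ε : ℂ) = δ * ((t ^ 2 : ℝ) : ℂ) + δ := by rw [← hδ1]; push_cast; ring
    rw [e1, e2, ← Matrix.fromBlocks_one, Matrix.fromBlocks_smul, Matrix.fromBlocks_conjTranspose,
      Matrix.fromBlocks_multiply, Matrix.fromBlocks_multiply, Matrix.fromBlocks_add,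
      Matrix.fromBlocks_add]
    simp only [Matrix.conjTranspose_conjTranspose, Matrix.conjTranspose_zero,
      Matrix.conjTranspose_one, Matrix.zero_mul, Matrix.mul_zero, Matrix.one_mul, Matrix.mul_one,
      add_zero, zero_add, smul_zero]
    congr 1
    · simp only [Matrix.mul_add, Matrix.add_mul, Matrix.mul_smul, Matrix.smul_mul, Matrix.mul_one,
        smul_sub, add_smul, smul_smul]
      abel
    · rw [Complex.ofReal_mul, add_smul]
      abel

/-- The amplifications of the transfer map are contractive. -/
lemma osyNorm_ampTransfer_le {m p : ℕ} {n : Type*} [Fintype n] [DecidableEq n]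
    (x : Matrix (Fin m) (Fin p) A) (y : Matrix (Fin p) n (B ω)) :
    osyNorm ω (ampTransfer hω x y) ≤ cstarNorms A m p x * osyNorm ω y := by
  have hx0 := cstarNorms_nonneg x
  have hy0 := osyNorm_nonneg y
  -- Enlarging both norms by δ makes them strictly positive, as the rescaling needs; δ → 0 at the
  -- end.
  have key : ∀ δ : ℝ, 0 < δ →
      osyNorm ω (ampTransfer hω x y) ≤ (cstarNorms A m p x + δ) * (osyNorm ω y + δ) := by
    intro δ hδ
    have ht : 0 < cstarNorms A m p x + δ := by positivity
    have hs : 0 < osyNorm ω y + δ := by positivity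
    -- With s = ‖y‖ + δ and t = ‖x‖ + δ, the diagonal (s, s) is first rescaled to (s/t, s t). The
    -- factor t² on the first entry then yields (s t, s t).
    have h := ((adm_of_lt (lt_add_of_pos_right (osyNorm ω y) hδ)).scale hs
      (div_pos hs ht)).ampTransfer hω (div_pos hs ht).le
      (le_add_of_nonneg_right hδ.le : cstarNorms A m p x ≤ _)
    refine osyNorm_le (by positivity) ?_
    convert h using 1 <;> field_simp
  have hc : Filter.Tendsto (fun δ : ℝ => (cstarNorms A m p x + δ) * (osyNorm ω y + δ))
      (nhdsWithin 0 (Set.Ioi 0)) (nhds ((cstarNorms A m p x + 0) * (osyNorm ω y + 0))) :=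
    (Continuous.tendsto (by fun_prop) 0).mono_left nhdsWithin_le_nhds
  rw [add_zero, add_zero] at hc
  exact ge_of_tendsto hc (Filter.eventually_of_mem self_mem_nhdsWithin key)

end Transfer

/-! ### Bounded Haagerup factorizations of matrices -/

section Factorization

variable {A : Type u} [CStarAlgebra A] (ω : State (AZ A))

/-- `y = u ⊙ v` with `‖u‖ ≤ C` and `‖v‖ ≤ C`. -/
def HasFactorization {m n : ℕ} (C : ℝ) (y : Matrix (Fin m) (Fin n) (A ⊗[ℂ] B ω)) : Prop :=
  ∃ (p : ℕ) (u : Matrix (Fin m) (Fin p) A) (v : Matrix (Fin p) (Fin n) (B ω)),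
    y = Matrix.of (fun i j => ∑ k, u i k ⊗ₜ[ℂ] v k j) ∧ cstarNorms A m p u ≤ C ∧
      osyNorms ω p n v ≤ C

variable {ω}

lemma HasFactorization.zero {m n : ℕ} :
    HasFactorization ω 0 (0 : Matrix (Fin m) (Fin n) (A ⊗[ℂ] B ω)) := by
  refine ⟨0, 0, 0, ?_, ?_, osyNorm_le le_rfl (Adm.zero le_rfl le_rfl)⟩
  · ext i j
    simp
  · let := CStarAlgebra.spectralOrder A
    let := CStarAlgebra.spectralOrderedRing A
    exact (norm_zero (E := CStarMatrix (Fin m) (Fin 0) A)).le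

/-- Factorizations add by placing the left factors side by side and stacking the right factors. -/
lemma HasFactorization.add {m n : ℕ} {C C' : ℝ} {x y : Matrix (Fin m) (Fin n) (A ⊗[ℂ] B ω)}
    (hx : HasFactorization ω C x) (hy : HasFactorization ω C' y) :
    HasFactorization ω (C + C') (x + y) := by
  obtain ⟨p, u, v, rfl, hu, hv⟩ := hx
  obtain ⟨q, u', v', rfl, hu', hv'⟩ := hy
  refine ⟨p + q, Matrix.of fun i => Fin.append (u i) (u' i),
    Matrix.of fun k j => Fin.append (fun k => v k j) (fun k => v' k j) k, ?_,
    (cstarNorms_append_le u u').trans (add_le_add hu hu'),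
    (osyNorms_append_le v v').trans (add_le_add hv hv')⟩
  ext i j
  simp [Fin.sum_univ_add]

lemma HasFactorization.single {m n : ℕ} {R : ℝ} (i : Fin m) (j : Fin n) {x : A ⊗[ℂ] B ω}
    (hx : haagerupNorm (cstarNorms A) (osyNorms ω) x < R) :
    HasFactorization ω (Real.sqrt R) (Matrix.single i j x) := by
  -- The balanced form bounds each factor separately by √R. Padding u with zero rows and v with zero
  -- columns then moves the tensor to the position (i, j).
  obtain ⟨p, u, v, rfl, hu, hv⟩ := exists_haagerup_balanced (haagerupData ω) hx
  refine ⟨p, Matrix.of fun i' k => if i' = i then u 0 k else 0,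
    Matrix.of fun k j' => if j' = j then v k 0 else 0, ?_,
    (cstarNorms_padRow_le i u).trans hu.le, (osyNorm_padCol_le j v).trans hv.le⟩
  ext i' j'
  rw [Matrix.single_apply, Matrix.of_apply]
  simp only [Matrix.of_apply]
  by_cases h : i = i' <;> by_cases h' : j = j'
  · subst h h'
    simp
  · simp [h, h', Ne.symm h']
  · simp [h, h', Ne.symm h]
  · simp [h, h', Ne.symm h]

/-- Matrices with entries of bounded Haagerup norm have uniformly bounded factorizations. -/
lemma hasFactorization_of_entries {m n : ℕ} {R : ℝ} {y : Matrix (Fin m) (Fin n) (A ⊗[ℂ] B ω)}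
    (hy : ∀ i j, haagerupNorm (cstarNorms A) (osyNorms ω) (y i j) < R) :
    HasFactorization ω (m * n * Real.sqrt R) y := by
  -- The matrix is a sum of m n single-entry matrices, each contributing √R to the bound of both
  -- factors.
  have key : ∀ s : Finset (Fin m × Fin n), HasFactorization ω (s.card * Real.sqrt R)
      (∑ q ∈ s, Matrix.single q.1 q.2 (y q.1 q.2)) := fun s => by
    classical
    induction s using Finset.induction_on with
    | empty => simpa using HasFactorization.zero
    | insert q s hq ih =>
      rw [Finset.sum_insert hq, Finset.card_insert_of_notMem hq]
      convert (HasFactorization.single q.1 q.2 (hy q.1 q.2)).add ih using 1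
      push_cast
      ring
  have h := key Finset.univ
  rw [Fintype.sum_prod_type] at h
  have e : ∑ i, ∑ j, Matrix.single i j (y i j) = y := (Matrix.matrix_eq_sum_single y).symm
  simpa [e] using h

/-- Shows that the infimum defining the Haagerup norm runs over a nonempty set; with the convention
inf ∅ = 0 no lower bound for it would follow otherwise. -/
lemma exists_hasFactorization {m n : ℕ} (y : Matrix (Fin m) (Fin n) (A ⊗[ℂ] B ω)) :
    ∃ C, HasFactorization ω C y := by
  obtain ⟨M, hM⟩ := (Set.finite_range fun q : Fin m × Fin n =>
    haagerupNorm (cstarNorms A) (osyNorms ω) (y q.1 q.2)).bddAbove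
  exact ⟨_, hasFactorization_of_entries (R := M + 1) fun i j =>
    (hM ⟨(i, j), rfl⟩).trans_lt (lt_add_one M)⟩

lemma HasFactorization.haagerupNorms_le {m n : ℕ} {C : ℝ} (hC : 0 ≤ C)
    {y : Matrix (Fin m) (Fin n) (A ⊗[ℂ] B ω)} (hy : HasFactorization ω C y) :
    haagerupNorms (cstarNorms A) (osyNorms ω) m n y ≤ C * C := by
  obtain ⟨p, u, v, h, hu, hv⟩ := hy
  refine le_trans (b := cstarNorms A m p u * osyNorms ω p n v)
    (csInf_le ⟨0, ?_⟩ ⟨p, u, v, h, rfl⟩) (mul_le_mul hu hv (osyNorm_nonneg v) hC)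
  rintro _ ⟨p, u, v, _, rfl⟩
  exact mul_nonneg (cstarNorms_nonneg u) (osyNorm_nonneg v)

end Factorization

/-! ### Haagerup contractivity and extension to the completion -/

section Extension

variable {A : Type u} [CStarAlgebra A] {ω : State (AZ A)}
  (hω : ∀ x : AZ A, ω.toCLM (shift A x) = ω.toCLM x)

/-- The linearized map sends u ⊙ v to [∑ₖ E(u_ik, v_kj)], so the bilinear estimate applies to each
factorization. The inner size p is arbitrary, which is why that estimate was proved for rectangular
matrices. -/
lemma osyNorms_map_lift_transfer_le {m n : ℕ} (x : Matrix (Fin m) (Fin n) (A ⊗[ℂ] B ω)) :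
    osyNorms ω m n (x.map (TensorProduct.lift (transfer ω hω)))
      ≤ haagerupNorms (cstarNorms A) (osyNorms ω) m n x := by
  obtain ⟨C, p, u, v, h, -, -⟩ := exists_hasFactorization x
  refine le_csInf ⟨_, p, u, v, h, rfl⟩ ?_
  rintro _ ⟨p, u, v, rfl, rfl⟩
  refine le_of_eq_of_le (congrArg (osyNorms ω m n) ?_) (osyNorm_ampTransfer_le hω u v)
  ext i j
  simp [ampTransfer]

/-- The linear map `a ⊗ b ↦ E (a, b)`, continuous for the Haagerup norm. -/
noncomputable def haagerupTransfer : AlgHaagerup ω →L[ℂ] B ω :=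
  LinearMap.mkContinuous (show AlgHaagerup ω →ₗ[ℂ] B ω from TensorProduct.lift (transfer ω hω)) 1
    fun x => by
      rw [one_mul]
      -- Both seminorms are by definition the 1 × 1 matrix norms.
      exact osyNorms_map_lift_transfer_le hω (Matrix.of fun _ _ : Fin 1 => x)

/-- The extension of the transfer map to the Haagerup tensor product. -/
noncomputable def completedTransfer : Haagerup ω →L[ℂ] Completion (B ω) :=
  (haagerupTransfer hω).completion

lemma completedTransfer_coe (x : AlgHaagerup ω) :
    completedTransfer hω (x : Haagerup ω) = (haagerupTransfer hω x : Completion (B ω)) :=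
  Completion.map_coe (haagerupTransfer hω).uniformContinuous x

/-- An extension to completions of a contraction for `νE` and `νF` is a contraction for the extended
norms, if the norms `νE` are bounded in terms of the norms of the entries. -/
lemma completionNorms_map_le {E F : Type*} [SeminormedAddCommGroup E] [UniformSpace F]
    {νE : MatrixNorms E} {νF : MatrixNorms F} {m n : ℕ} {φ : E → F}
    (hφ : ∀ x, νF m n (x.map φ) ≤ νE m n x)
    (hE : ∀ R : ℝ, ∃ C : ℝ, 0 ≤ C ∧ ∀ y : Matrix (Fin m) (Fin n) E, (∀ i j, ‖y i j‖ < R) →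
      νE m n y ≤ C)
    {Φ : Completion E → Completion F} (hΦ : Continuous Φ) (hΦφ : ∀ x : E, Φ x = φ x)
    (x : Matrix (Fin m) (Fin n) (Completion E)) :
    completionNorms νF m n (x.map Φ) ≤ completionNorms νE m n x := by
  refine le_csInf ?_ ?_
  -- The set of admissible radii for x must be nonempty. The matrices with entries of norm below M +
  -- 1 form an open neighbourhood of x, in which matrices over E are dense; `hE` puts all of those
  -- in one ball.
  · obtain ⟨M, hM⟩ := (Set.finite_range fun q : Fin m × Fin n => ‖x q.1 q.2‖).bddAbove
    obtain ⟨C, hC, hCy⟩ := hE (M + 1)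
    refine ⟨C, hC, ?_⟩
    let U : Set (Matrix (Fin m) (Fin n) (Completion E)) := {z | ∀ i j, ‖z i j‖ < M + 1}
    have hU : IsOpen U := by
      simp only [U, Set.ofPred_forall]
      exact isOpen_iInter_of_finite fun i => isOpen_iInter_of_finite fun j =>
        isOpen_lt (by fun_prop) continuous_const
    have hxU : x ∈ U := fun i j => (hM ⟨(i, j), rfl⟩).trans_lt (lt_add_one M)
    have hd : DenseRange
        (fun y : Matrix (Fin m) (Fin n) E => y.map ((↑) : E → Completion E)) :=
      DenseRange.piMap fun _ => DenseRange.piMap fun _ => Completion.denseRange_coe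
    refine closure_mono ?_ (hd.open_subset_closure_inter hU hxU)
    rintro _ ⟨hz, y, rfl⟩
    exact ⟨y, hCy y fun i j => by simpa using hz i j, rfl⟩
  · rintro r ⟨hr, hx⟩
    -- Each radius admissible for x is admissible for its image: φ maps the ball of radius r into
    -- the ball of radius r, and continuity passes this to closures.
    refine csInf_le ⟨0, fun _ h => h.1⟩ ⟨hr, ?_⟩
    have hc : Continuous fun z : Matrix (Fin m) (Fin n) (Completion E) => z.map Φ :=
      continuous_id.matrix_map hΦ
    refine closure_mono ?_ (image_closure_subset_closure_image hc ⟨x, hx, rfl⟩)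
    rintro _ ⟨_, ⟨y, hy, rfl⟩, rfl⟩
    refine ⟨y.map φ, (hφ y).trans hy, ?_⟩
    ext i j
    exact (hΦφ (y i j)).symm

lemma isCompletelyContractive_completedTransfer :
    IsCompletelyContractive (completionNorms (algHaagerupNorms ω))
      (completionNorms (osyNorms ω)) (completedTransfer hω).toLinearMap := fun n x =>
  completionNorms_map_le (φ := haagerupTransfer hω)
    (fun x => osyNorms_map_lift_transfer_le hω x)
    (fun R => ⟨_, mul_self_nonneg _, fun y hy =>
      (hasFactorization_of_entries (R := R) hy).haagerupNorms_le (by positivity)⟩)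
    (completedTransfer hω).continuous (completedTransfer_coe hω) x

end Extension

end OPS

/-! ### Assembly of the theorem -/

theorem mainTheorem5 {A : Type u} [CStarAlgebra A] (ω : OPS.State (OPS.AZ A))
    (hω : ∀ x : OPS.AZ A, ω.toCLM (OPS.shift A x) = ω.toCLM x) :
    ∃ E : A →ₗ[ℂ] OPS.B ω →ₗ[ℂ] OPS.B ω,
      (∀ (a : A) (r : OPS.AR A), E a (OPS.cls ω r) = OPS.cls ω (OPS.xiR A a r)) ∧
      OPS.IsCompletelyContractiveBilinear (OPS.cstarNorms A) (OPS.osyNorms ω) (OPS.osyNorms ω) E ∧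
      OPS.IsCompletelyContractive (OPS.haagerupNorms (OPS.cstarNorms A) (OPS.osyNorms ω))
        (OPS.osyNorms ω) (TensorProduct.lift E) ∧
      ∃ Φ : OPS.Haagerup ω →L[ℂ] UniformSpace.Completion (OPS.B ω),
        (∀ (a : A) (b : OPS.B ω),
          Φ (OPS.AlgHaagerup.tmul ω a b : OPS.Haagerup ω)
            = (E a b : UniformSpace.Completion (OPS.B ω))) ∧
        Φ (OPS.AlgHaagerup.tmul ω 1 (OPS.unitB ω) : OPS.Haagerup ω)
          = (OPS.unitB ω : UniformSpace.Completion (OPS.B ω)) ∧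
        OPS.IsCompletelyContractive (OPS.completionNorms (OPS.algHaagerupNorms ω))
          (OPS.completionNorms (OPS.osyNorms ω)) Φ.toLinearMap := by
  have hΦ : ∀ (a : A) (b : OPS.B ω),
      OPS.completedTransfer hω (OPS.AlgHaagerup.tmul ω a b : OPS.Haagerup ω)
        = (OPS.transfer ω hω a b : UniformSpace.Completion (OPS.B ω)) := fun a b =>
    (OPS.completedTransfer_coe hω _).trans
      (congrArg _ (TensorProduct.lift.tmul (f' := OPS.transfer ω hω) a b))
  refine ⟨OPS.transfer ω hω, fun a r => ?_, fun n x y => OPS.osyNorm_ampTransfer_le hω x y,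
    fun n x => OPS.osyNorms_map_lift_transfer_le hω x, OPS.completedTransfer hω, hΦ, ?_,
    OPS.isCompletelyContractive_completedTransfer hω⟩
  · rw [OPS.transfer_cls, OPS.xiR_eq]
  · rw [hΦ, OPS.transfer_unitB, map_one, OPS.unitB]
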